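/- Let $p$ be a prime, $\Lambda=GL_3(\mathbb Z)$ and $G_p=GL_3(\mathbb Z[1/p])$. Let $L_{\mathbb Q}(\Lambda,G_p)$ be the Hecke ring: the finite $\mathbb Q$-linear combinations of double cosets $\Lambda g\Lambda$ with $g\in G_p$, each double coset being identified with the formal sum $\sum_j(\Lambda g_j)$ of the finitely many cosets $\Lambda g_j$ into which it decomposes. For integers $\delta_1,\delta_2,\delta_3$ let $t(p^{\delta_1},p^{\delta_2},p^{\delta_3})$ denote the double coset of $\mathrm{diag}(p^{\delta_1},p^{\delta_2},p^{\delta_3})$. The spherical map $\omega$ is the $\mathbb Q$-linear map to $\mathbb Q[x_1^{\pm1},x_2^{\pm1},x_3^{\pm1}]$ given by $\omega\big(\sum_j a_j(\Lambda g_j)\big)=\sum_j a_j\,\omega((\Lambda g_j))$, where $$\omega((\Lambda g))=\prod_{i=1}^{3}(x_ip^{-i})^{\delta_i}$$ if $g$ is an upper triangular representative of the coset $\Lambda g$ with diagonal entries $p^{\delta_1},p^{\delta_2},p^{\delta_3}$ (such a representative exists and the $\delta_i$ are uniquely determined by the coset). For integers $i\ge j\ge k\ge 0$ let $\mathrm{sym}_{i,j,k}$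 be the sum of all distinct monomials obtained from $x_1^ix_2^jx_3^k$ by permuting the variables. Then the images $\omega(t(1,p^a,p^b))$, $0\le a\le b\le 6$, are the following: 1) $\omega(t(1,1,1))=1$; 2) $\omega(t(1,1,p))=\frac{\mathrm{sym}_{1,0,0}}{p}$; 3) $\omega(t(1,p,p))=\frac{\mathrm{sym}_{1,1,0}}{p^{3}}$; 4) $\omega(t(1,1,p^{2}))=\frac{(p-1)\,\mathrm{sym}_{1,1,0}}{p^{3}}+\frac{\mathrm{sym}_{2,0,0}}{p^{2}}$; 5) $\omega(t(1,p,p^{2}))=\frac{(2p^2-p-1)\,\mathrm{sym}_{1,1,1}}{p^{6}}+\frac{\mathrm{sym}_{2,1,0}}{p^{4}}$; 6) $\omega(t(1,p^{2},p^{2}))=\frac{(p-1)\,\mathrm{sym}_{2,1,1}}{p^{7}}+\frac{\mathrm{sym}_{2,2,0}}{p^{6}}$; 7) $\omega(t(1,1,p^{3}))=\frac{(p^2-2p+1)\,\mathrm{sym}_{1,1,1}}{p^{5}}+\frac{(p^2-p)\,\mathrm{sym}_{2,1,0}}{p^{5}}+\frac{\mathrm{sym}_{3,0,0}}{p^{3}}$;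 8) $\omega(t(1,p,p^{3}))=\frac{(2p-2)\,\mathrm{sym}_{2,1,1}}{p^{6}}+\frac{(p-1)\,\mathrm{sym}_{2,2,0}}{p^{6}}+\frac{\mathrm{sym}_{3,1,0}}{p^{5}}$; 9) $\omega(t(1,p^{2},p^{3}))=\frac{(2p-2)\,\mathrm{sym}_{2,2,1}}{p^{8}}+\frac{(p-1)\,\mathrm{sym}_{3,1,1}}{p^{8}}+\frac{\mathrm{sym}_{3,2,0}}{p^{7}}$; 10) $\omega(t(1,p^{3},p^{3}))=\frac{(p^2-2p+1)\,\mathrm{sym}_{2,2,2}}{p^{11}}+\frac{(p^2-p)\,\mathrm{sym}_{3,2,1}}{p^{11}}+\frac{\mathrm{sym}_{3,3,0}}{p^{9}}$; 11) $\omega(t(1,1,p^{4}))=\frac{(p^2-2p+1)\,\mathrm{sym}_{2,1,1}}{p^{6}}+\frac{(p^2-p)\,\mathrm{sym}_{2,2,0}}{p^{6}}+\frac{(p^2-p)\,\mathrm{sym}_{3,1,0}}{p^{6}}+\frac{\mathrm{sym}_{4,0,0}}{p^{4}}$; 12) $\omega(t(1,p,p^{4}))=\frac{(2p^2-3p+1)\,\mathrm{sym}_{2,2,1}}{p^{8}}+\frac{(2p^2-2p)\,\mathrm{sym}_{3,1,1}}{p^{8}}+\frac{(p^2-p)\,\mathrm{sym}_{3,2,0}}{p^{8}}+\frac{\mathrm{sym}_{4,1,0}}{p^{6}}$;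 13) $\omega(t(1,p^{2},p^{4}))=\frac{(3p^3-4p^2+2p-1)\,\mathrm{sym}_{2,2,2}}{p^{11}}+\frac{(2p^3-3p^2+p)\,\mathrm{sym}_{3,2,1}}{p^{11}}+\frac{(p^3-p^2)\,\mathrm{sym}_{3,3,0}}{p^{11}}+\frac{(p^3-p^2)\,\mathrm{sym}_{4,1,1}}{p^{11}}+\frac{\mathrm{sym}_{4,2,0}}{p^{8}}$; 14) $\omega(t(1,p^{3},p^{4}))=\frac{(2p^2-3p+1)\,\mathrm{sym}_{3,2,2}}{p^{12}}+\frac{(2p^2-2p)\,\mathrm{sym}_{3,3,1}}{p^{12}}+\frac{(p^2-p)\,\mathrm{sym}_{4,2,1}}{p^{12}}+\frac{\mathrm{sym}_{4,3,0}}{p^{10}}$; 15) $\omega(t(1,p^{4},p^{4}))=\frac{(p^2-2p+1)\,\mathrm{sym}_{3,3,2}}{p^{14}}+\frac{(p^2-p)\,\mathrm{sym}_{4,2,2}}{p^{14}}+\frac{(p^2-p)\,\mathrm{sym}_{4,3,1}}{p^{14}}+\frac{\mathrm{sym}_{4,4,0}}{p^{12}}$; 16) $\omega(t(1,1,p^{5}))=\frac{(p^2-2p+1)\,\mathrm{sym}_{2,2,1}}{p^{7}}+\frac{(p^2-2p+1)\,\mathrm{sym}_{3,1,1}}{p^{7}}+\frac{(p^2-p)\,\mathrm{sym}_{3,2,0}}{p^{7}}+\frac{(p^2-p)\,\mathrm{sym}_{4,1,0}}{p^{7}}+\frac{\mathrm{sym}_{5,0,0}}{p^{5}}$;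 17) $\omega(t(1,p,p^{5}))=\frac{(2p^2-4p+2)\,\mathrm{sym}_{2,2,2}}{p^{9}}+\frac{(2p^2-3p+1)\,\mathrm{sym}_{3,2,1}}{p^{9}}+\frac{(p^2-p)\,\mathrm{sym}_{3,3,0}}{p^{9}}+\frac{(2p^2-2p)\,\mathrm{sym}_{4,1,1}}{p^{9}}+\frac{(p^2-p)\,\mathrm{sym}_{4,2,0}}{p^{9}}+\frac{\mathrm{sym}_{5,1,0}}{p^{7}}$; 18) $\omega(t(1,p^{2},p^{5}))=\frac{(3p^3-5p^2+3p-1)\,\mathrm{sym}_{3,2,2}}{p^{12}}+\frac{(2p^3-4p^2+2p)\,\mathrm{sym}_{3,3,1}}{p^{12}}+\frac{(2p^3-3p^2+p)\,\mathrm{sym}_{4,2,1}}{p^{12}}+\frac{(p^3-p^2)\,\mathrm{sym}_{4,3,0}}{p^{12}}+\frac{(p^3-p^2)\,\mathrm{sym}_{5,1,1}}{p^{12}}+\frac{\mathrm{sym}_{5,2,0}}{p^{9}}$; 19) $\omega(t(1,p^{3},p^{5}))=\frac{(3p^3-5p^2+3p-1)\,\mathrm{sym}_{3,3,2}}{p^{14}}+\frac{(2p^3-4p^2+2p)\,\mathrm{sym}_{4,2,2}}{p^{14}}+\frac{(2p^3-3p^2+p)\,\mathrm{sym}_{4,3,1}}{p^{14}}+\frac{(p^3-p^2)\,\mathrm{sym}_{4,4,0}}{p^{14}}+\frac{(p^3-p^2)\,\mathrm{sym}_{5,2,1}}{p^{14}}+\frac{\mathrm{sym}_{5,3,0}}{p^{11}}$;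 20) $\omega(t(1,p^{4},p^{5}))=\frac{(2p^2-4p+2)\,\mathrm{sym}_{3,3,3}}{p^{15}}+\frac{(2p^2-3p+1)\,\mathrm{sym}_{4,3,2}}{p^{15}}+\frac{(2p^2-2p)\,\mathrm{sym}_{4,4,1}}{p^{15}}+\frac{(p^2-p)\,\mathrm{sym}_{5,2,2}}{p^{15}}+\frac{(p^2-p)\,\mathrm{sym}_{5,3,1}}{p^{15}}+\frac{\mathrm{sym}_{5,4,0}}{p^{13}}$; 21) $\omega(t(1,p^{5},p^{5}))=\frac{(p^2-2p+1)\,\mathrm{sym}_{4,3,3}}{p^{17}}+\frac{(p^2-2p+1)\,\mathrm{sym}_{4,4,2}}{p^{17}}+\frac{(p^2-p)\,\mathrm{sym}_{5,3,2}}{p^{17}}+\frac{(p^2-p)\,\mathrm{sym}_{5,4,1}}{p^{17}}+\frac{\mathrm{sym}_{5,5,0}}{p^{15}}$; 22) $\omega(t(1,1,p^{6}))=\frac{(p^2-2p+1)\,\mathrm{sym}_{2,2,2}}{p^{8}}+\frac{(p^2-2p+1)\,\mathrm{sym}_{3,2,1}}{p^{8}}+\frac{(p^2-p)\,\mathrm{sym}_{3,3,0}}{p^{8}}+\frac{(p^2-2p+1)\,\mathrm{sym}_{4,1,1}}{p^{8}}+\frac{(p^2-p)\,\mathrm{sym}_{4,2,0}}{p^{8}}+\frac{(p^2-p)\,\mathrm{sym}_{5,1,0}}{p^{8}}+\frac{\mathrm{sym}_{6,0,0}}{p^{6}}$;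 23) $\omega(t(1,p,p^{6}))=\frac{(2p^2-4p+2)\,\mathrm{sym}_{3,2,2}}{p^{10}}+\frac{(2p^2-3p+1)\,\mathrm{sym}_{3,3,1}}{p^{10}}+\frac{(2p^2-3p+1)\,\mathrm{sym}_{4,2,1}}{p^{10}}+\frac{(p^2-p)\,\mathrm{sym}_{4,3,0}}{p^{10}}+\frac{(2p^2-2p)\,\mathrm{sym}_{5,1,1}}{p^{10}}+\frac{(p^2-p)\,\mathrm{sym}_{5,2,0}}{p^{10}}+\frac{\mathrm{sym}_{6,1,0}}{p^{8}}$; 24) $\omega(t(1,p^{2},p^{6}))=\frac{(3p^3-6p^2+4p-1)\,\mathrm{sym}_{3,3,2}}{p^{13}}+\frac{(3p^3-5p^2+3p-1)\,\mathrm{sym}_{4,2,2}}{p^{13}}+\frac{(2p^3-4p^2+2p)\,\mathrm{sym}_{4,3,1}}{p^{13}}+\frac{(p^3-p^2)\,\mathrm{sym}_{4,4,0}}{p^{13}}+\frac{(2p^3-3p^2+p)\,\mathrm{sym}_{5,2,1}}{p^{13}}+\frac{(p^3-p^2)\,\mathrm{sym}_{5,3,0}}{p^{13}}+\frac{(p^3-p^2)\,\mathrm{sym}_{6,1,1}}{p^{13}}+\frac{\mathrm{sym}_{6,2,0}}{p^{10}}$;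 25) $\omega(t(1,p^{3},p^{6}))=\frac{(4p^3-7p^2+5p-2)\,\mathrm{sym}_{3,3,3}}{p^{15}}+\frac{(3p^3-6p^2+4p-1)\,\mathrm{sym}_{4,3,2}}{p^{15}}+\frac{(2p^3-4p^2+2p)\,\mathrm{sym}_{4,4,1}}{p^{15}}+\frac{(2p^3-4p^2+2p)\,\mathrm{sym}_{5,2,2}}{p^{15}}+\frac{(2p^3-3p^2+p)\,\mathrm{sym}_{5,3,1}}{p^{15}}+\frac{(p^3-p^2)\,\mathrm{sym}_{5,4,0}}{p^{15}}+\frac{(p^3-p^2)\,\mathrm{sym}_{6,2,1}}{p^{15}}+\frac{\mathrm{sym}_{6,3,0}}{p^{12}}$; 26) $\omega(t(1,p^{4},p^{6}))=\frac{(3p^3-6p^2+4p-1)\,\mathrm{sym}_{4,3,3}}{p^{17}}+\frac{(3p^3-5p^2+3p-1)\,\mathrm{sym}_{4,4,2}}{p^{17}}+\frac{(2p^3-4p^2+2p)\,\mathrm{sym}_{5,3,2}}{p^{17}}+\frac{(2p^3-3p^2+p)\,\mathrm{sym}_{5,4,1}}{p^{17}}+\frac{(p^3-p^2)\,\mathrm{sym}_{5,5,0}}{p^{17}}+\frac{(p^3-p^2)\,\mathrm{sym}_{6,2,2}}{p^{17}}+\frac{(p^3-p^2)\,\mathrm{sym}_{6,3,1}}{p^{17}}+\frac{\mathrm{sym}_{6,4,0}}{p^{14}}$;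 27) $\omega(t(1,p^{5},p^{6}))=\frac{(2p^2-4p+2)\,\mathrm{sym}_{4,4,3}}{p^{18}}+\frac{(2p^2-3p+1)\,\mathrm{sym}_{5,3,3}}{p^{18}}+\frac{(2p^2-3p+1)\,\mathrm{sym}_{5,4,2}}{p^{18}}+\frac{(2p^2-2p)\,\mathrm{sym}_{5,5,1}}{p^{18}}+\frac{(p^2-p)\,\mathrm{sym}_{6,3,2}}{p^{18}}+\frac{(p^2-p)\,\mathrm{sym}_{6,4,1}}{p^{18}}+\frac{\mathrm{sym}_{6,5,0}}{p^{16}}$; 28) $\omega(t(1,p^{6},p^{6}))=\frac{(p^2-2p+1)\,\mathrm{sym}_{4,4,4}}{p^{20}}+\frac{(p^2-2p+1)\,\mathrm{sym}_{5,4,3}}{p^{20}}+\frac{(p^2-2p+1)\,\mathrm{sym}_{5,5,2}}{p^{20}}+\frac{(p^2-p)\,\mathrm{sym}_{6,3,3}}{p^{20}}+\frac{(p^2-p)\,\mathrm{sym}_{6,4,2}}{p^{20}}+\frac{(p^2-p)\,\mathrm{sym}_{6,5,1}}{p^{20}}+\frac{\mathrm{sym}_{6,6,0}}{p^{18}}$.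 -/

import Mathlib

open scoped MatrixGroups

noncomputable section

namespace GLHecke

/-- The ring `ℤ[1/p]`, as a subring of `ℚ`. -/
def zInv (p : ℕ) : Subring ℚ := Subring.closure {(p : ℚ)⁻¹}

/-- `Λ = GL_n(ℤ)`, as a subgroup of `GL_n(ℚ)`. -/
def Lam (n : ℕ) : Subgroup (GL (Fin n) ℚ) :=
  (Matrix.GeneralLinearGroup.map (n := Fin n) (Int.castRingHom ℚ)).range

/-- `G_p = GL_n(ℤ[1/p])`, as a subgroup of `GL_n(ℚ)`. -/
def Gp (n p : ℕ) : Subgroup (GL (Fin n) ℚ) :=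
  (Matrix.GeneralLinearGroup.map (n := Fin n) (zInv p).subtype).range

/-- The Hecke ring `L_ℚ(Λ, G_p)` (as a `ℚ`-module): finite `ℚ`-linear combinations of the double
cosets `Λ g Λ` with `g ∈ G_p`. -/
abbrev LQ (n p : ℕ) : Type := HeckeRing (Gp n p).toSubmonoid (Lam n) ℚ

/-- `p` as a unit of `ℤ[1/p]`. -/
def pUnit (p : ℕ) [Fact p.Prime] : (zInv p)ˣ where
  val := (p : zInv p)
  inv := ⟨(p : ℚ)⁻¹, Subring.subset_closure rfl⟩
  val_inv := Subtype.ext (by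
    have h : (p : ℚ) ≠ 0 := Nat.cast_ne_zero.mpr (Fact.out : p.Prime).ne_zero
    simp [h])
  inv_val := Subtype.ext (by
    have h : (p : ℚ) ≠ 0 := Nat.cast_ne_zero.mpr (Fact.out : p.Prime).ne_zero
    simp [h])

/-- The invertible diagonal matrix with given units on the diagonal. -/
def diagGL {n : ℕ} {R : Type*} [CommRing R] (u : Fin n → Rˣ) : GL (Fin n) R where
  val := Matrix.diagonal fun i => (u i : R)
  inv := Matrix.diagonal fun i => ((u i)⁻¹ : Rˣ)
  val_inv := by simp
  inv_val := by simp

/-- `diag(p^{δ_1}, …, p^{δ_n})` as an element of `G_p`. -/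
def diagP {n : ℕ} (p : ℕ) [Fact p.Prime] (δ : Fin n → ℤ) : (Gp n p).toSubmonoid :=
  ⟨Matrix.GeneralLinearGroup.map (zInv p).subtype (diagGL fun i => pUnit p ^ δ i), ⟨_, rfl⟩⟩

/-- The Hecke operator `t(p^{δ_1}, …, p^{δ_n})`: the double coset
`Λ diag(p^{δ_1}, …, p^{δ_n}) Λ`, with coefficient `1`, as an element of the Hecke ring. -/
def t {n : ℕ} (p : ℕ) [Fact p.Prime] (δ : Fin n → ℤ) : LQ n p :=
  HeckeCosetModule.of (Finsupp.single (HeckeCoset.mk (Lam n) (Lam n) (diagP p δ)) 1)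

/-- The field `ℚ(x_1, …, x_n)` of rational functions; it contains the Laurent polynomials, in which
the spherical map takes its values. -/
def RatFun (n : ℕ) : Type := FractionRing (MvPolynomial (Fin n) ℚ)

instance (n : ℕ) : Field (RatFun n) :=
  inferInstanceAs (Field (FractionRing (MvPolynomial (Fin n) ℚ)))

instance (n : ℕ) : Algebra (MvPolynomial (Fin n) ℚ) (RatFun n) :=
  inferInstanceAs (Algebra (MvPolynomial (Fin n) ℚ) (FractionRing (MvPolynomial (Fin n) ℚ)))

instance (n : ℕ) : IsFractionRing (MvPolynomial (Fin n) ℚ) (RatFun n) :=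
  inferInstanceAs (IsFractionRing (MvPolynomial (Fin n) ℚ)
    (FractionRing (MvPolynomial (Fin n) ℚ)))

/-- The variables; `x i` is `x_{i+1}` when the variables are numbered from `1`. -/
def x {n : ℕ} (i : Fin n) : RatFun n := algebraMap (MvPolynomial (Fin n) ℚ) (RatFun n)
  (MvPolynomial.X i)

/-- The cosets `Λ g`, `g ∈ GL_n(ℚ)`. -/
abbrev Coset (n : ℕ) : Type := Quotient (QuotientGroup.rightRel (Lam n))

/-- The coset `Λ g`. -/
abbrev Coset.mk {n : ℕ} (g : GL (Fin n) ℚ) : Coset n :=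
  Quotient.mk (QuotientGroup.rightRel (Lam n)) g

/-- The coset `c` contains an upper triangular matrix with diagonal `p^{δ_1}, …, p^{δ_n}`. -/
def HasDiag {n : ℕ} (p : ℕ) (c : Coset n) (δ : Fin n → ℤ) : Prop :=
  ∃ g : GL (Fin n) ℚ, Coset.mk g = c ∧ (∀ i j : Fin n, j < i → g i j = 0) ∧
    ∀ i : Fin n, g i i = (p : ℚ) ^ δ i

open Classical in
/-- The spherical map on cosets: `ω(Λ g) = ∏ (x_i p^{-i})^{δ_i}` (with `i` from `1` to `n`) for an
upper triangular matrix `g` with diagonal `p^{δ_1}, …, p^{δ_n}`. Every coset `Λ g` with `g ∈ G_p`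
contains such a matrix, and the exponents are unique (`HasDiag.unique`). -/
def ωCoset {n : ℕ} (p : ℕ) (c : Coset n) : RatFun n :=
  if h : ∃ δ : Fin n → ℤ, HasDiag p c δ then
    ∏ i : Fin n, (x i / (p : RatFun n) ^ ((i : ℕ) + 1)) ^ h.choose i
  else 0

/-- The set of the cosets `Λ g_j` into which a double coset `Λ g Λ` decomposes. -/
def cosets {n p : ℕ} (D : HeckeCoset (Gp n p).toSubmonoid (Lam n) (Lam n)) : Set (Coset n) :=
  {c | ∃ g : (Gp n p).toSubmonoid, HeckeCoset.mk (Lam n) (Lam n) g = D ∧ Coset.mk g.1 = c}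

/-- The spherical map `ω` on the Hecke ring: if `T = ∑ a_j (Λ g_j)` is the decomposition into
cosets, then `ω(T) = ∑ a_j ω(Λ g_j)`. (Double cosets are finite unions of cosets.) -/
def ω {n : ℕ} (p : ℕ) (T : LQ n p) : RatFun n :=
  Finsupp.sum (HeckeCosetModule.of.symm T) fun D a =>
    (a : RatFun n) * ∑ᶠ c ∈ cosets D, ωCoset p c

/-- The monomial symmetric polynomial `sym_{i,j,k}` in `x_1, x_2, x_3`: the sum of the distinct
monomials obtained from `x_1^i x_2^j x_3^k` by permuting the variables. -/
def sym (i j k : ℕ) : RatFun 3 :=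
  ∑ m ∈ (Finset.univ : Finset (Equiv.Perm (Fin 3))).image fun σ l => ![i, j, k] (σ l),
    ∏ l : Fin 3, x l ^ m l

theorem HasDiag.le {n p : ℕ} (hp : p.Prime) {c : Coset n} {δ ε : Fin n → ℤ}
    (h : HasDiag p c δ) (h' : HasDiag p c ε) (i : Fin n) : δ i ≤ ε i := by
  obtain ⟨g, rfl, hg, hgd⟩ := h
  obtain ⟨g', he, hg', hgd'⟩ := h'
  obtain ⟨γ, hγ⟩ : g' * g⁻¹ ∈ Lam n := by
    have := QuotientGroup.rightRel_apply.mp (Quotient.exact he.symm)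
    exact this
  have e : g'.val = (Matrix.GeneralLinearGroup.map (Int.castRingHom ℚ) γ).val * g.val := by
    rw [hγ, ← Units.val_mul]; simp
  have hT : Matrix.BlockTriangular g.val id := fun i j hij => hg i j hij
  have hT' : Matrix.BlockTriangular g'.val id := fun i j hij => hg' i j hij
  have : Invertible g.val := g.isUnit.invertible
  have hTi : Matrix.BlockTriangular (g⁻¹).val id := by
    have := Matrix.blockTriangular_inv_of_blockTriangular hT
    rwa [← Matrix.coe_units_inv] at this
  have hΓ : Matrix.BlockTriangular
      (Matrix.GeneralLinearGroup.map (Int.castRingHom ℚ) γ).val id := by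
    rw [hγ, Units.val_mul]; exact hT'.mul hTi
  have hd : (p : ℚ) ^ ε i = ((γ.val i i : ℤ) : ℚ) * (p : ℚ) ^ δ i := by
    rw [← hgd, ← hgd', e, Matrix.mul_apply, Finset.sum_eq_single i]
    · rfl
    · intro j _ hj
      rcases lt_or_gt_of_ne hj with h | h
      · rw [hΓ h, zero_mul]
      · rw [hT h, mul_zero]
    · simp
  have hp1 : (1 : ℚ) < p := by exact_mod_cast hp.one_lt
  have hp0 : (0 : ℚ) < p := by linarith
  have hγ1 : (1 : ℚ) ≤ ((γ.val i i : ℤ) : ℚ) := by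
    have : (0 : ℚ) < ((γ.val i i : ℤ) : ℚ) := by
      have h1 : (0 : ℚ) < (p : ℚ) ^ ε i := zpow_pos hp0 _
      rw [hd] at h1
      exact pos_of_mul_pos_left h1 (zpow_pos hp0 _).le
    exact_mod_cast this
  have : (p : ℚ) ^ δ i ≤ (p : ℚ) ^ ε i := by
    rw [hd]
    exact le_mul_of_one_le_left (zpow_pos hp0 _).le hγ1
  exact (zpow_le_zpow_iff_right₀ hp1).mp this

/-- The exponents `δ_1, …, δ_n` of a coset are unique. -/
theorem HasDiag.unique {n p : ℕ} (hp : p.Prime) {c : Coset n} {δ ε : Fin n → ℤ}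
    (h : HasDiag p c δ) (h' : HasDiag p c ε) : δ = ε :=
  funext fun i => le_antisymm (h.le hp h' i) (h'.le hp h i)

end GLHecke

end

open GLHecke

namespace GLHecke

/-! ### Residues and pairs of residues modulo powers of `p` under divisibility conditions. -/

section Counting

open Finset

/-! The cosets `Λ g` in the double coset of `diag(1, p^a, p^b)` have unique representatives in
Hermite normal form: upper triangular, diagonal `p^d0, p^d1, p^d2` with `d0 + d1 + d2 = a + b`,
entries above the diagonal reduced modulo the diagonal entry of their column. By elementary
divisors, such a matrix lies in the double coset exactly when its entries are not all divisible by
`p` and its minors of order two have gcd of valuation `a`; the determinant fixes the third divisor.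
These facts are `exists_mul_eq_herm`, `eq_of_mul_herm_eq_herm` and `hasType_iff`, combined in
`bijOn_hermReps`.

Since `ωCoset` depends only on the diagonal, the coefficient of `∏ (x_i p^{-i})^{d_i}` is the number
of admissible matrices with that diagonal. Matrices whose minors are divisible by `p^k` are counted
by solving one congruence `s t ≡ p^d1 w` modulo `p^k` under divisibility conditions on `s` and `t`
(`card_filter_dvd_adjugate`). Inclusion-exclusion then imposes the exact valuation and removes the
multiples of `p`, which are `p` times smaller reduced matrices (`card_filter_hasType`).

The counts are explicit polynomials in `p`, stored as lists of integer terms. Each entry of the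
table becomes a comparison of finitely many integer coefficients, uniform in `p` (`ω_t_eq_symComb`),
settled by evaluation. -/

theorem filter_dvd_range_mul {a : ℕ} (ha : 0 < a) (b : ℕ) :
    (range (a * b)).filter (a ∣ ·) = (range b).image (a * ·) := by
  ext x
  simp only [mem_filter, mem_range, mem_image]
  constructor
  · rintro ⟨hx, y, rfl⟩
    exact ⟨y, lt_of_mul_lt_mul_left hx ha.le, rfl⟩
  · rintro ⟨y, hy, rfl⟩
    exact ⟨Nat.mul_lt_mul_of_pos_left hy ha, dvd_mul_right _ _⟩

theorem filter_pow_dvd_range_pow {p : ℕ} (hp : 0 < p) {j n : ℕ} (h : j ≤ n) :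
    (range (p ^ n)).filter (p ^ j ∣ ·) = (range (p ^ (n - j))).image (p ^ j * ·) := by
  rw [← filter_dvd_range_mul (pow_pos hp j), ← pow_add, Nat.add_sub_cancel' h]

theorem card_filter_pow_dvd_range_pow {p : ℕ} (hp : 0 < p) {j n : ℕ} (h : j ≤ n) :
    ((range (p ^ n)).filter (p ^ j ∣ ·)).card = p ^ (n - j) := by
  rw [filter_pow_dvd_range_pow hp h, card_image_of_injective _
    (mul_right_injective₀ (pow_pos hp j).ne'), card_range]

/-- The number of pairs modulo `p ^ m` and `p ^ n`, divisible by `p ^ β` and `p ^ α`, whose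
product is divisible by `p ^ r`, in terms of the pairs modulo `p ^ (m - β)` and `p ^ (n - α)`. -/
theorem card_filter_dvd_and_mul_dvd {p : ℕ} (hp : 0 < p) {m n α β : ℕ} (hβ : β ≤ m) (hα : α ≤ n)
    (r : ℕ) :
    ((range (p ^ m) ×ˢ range (p ^ n)).filter fun x =>
      p ^ β ∣ x.1 ∧ p ^ α ∣ x.2 ∧ p ^ r ∣ x.1 * x.2).card =
    ((range (p ^ (m - β)) ×ˢ range (p ^ (n - α))).filter fun x =>
      p ^ (r - α - β) ∣ x.1 * x.2).card := by
  have key : ∀ s t : ℕ, p ^ r ∣ p ^ β * s * (p ^ α * t) ↔ p ^ (r - α - β) ∣ s * t := by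
    intro s t
    have e : p ^ β * s * (p ^ α * t) = p ^ (α + β) * (s * t) := by ring
    rw [e]
    rcases le_total r (α + β) with h | h
    · have h' : r - α - β = 0 := by omega
      simp [h', Dvd.dvd.mul_right (pow_dvd_pow p h) (s * t)]
    · have e2 : p ^ r = p ^ (α + β) * p ^ (r - α - β) := by
        rw [← pow_add]; congr 1; omega
      rw [e2, Nat.mul_dvd_mul_iff_left (pow_pos hp _)]
  symm
  apply card_bij fun x _ => (p ^ β * x.1, p ^ α * x.2)
  · rintro ⟨s, t⟩ h
    simp only [mem_filter, mem_product, mem_range] at h ⊢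
    refine ⟨⟨?_, ?_⟩, dvd_mul_right _ _, dvd_mul_right _ _, (key s t).2 h.2⟩
    · calc p ^ β * s < p ^ β * p ^ (m - β) := Nat.mul_lt_mul_of_pos_left h.1.1 (pow_pos hp _)
        _ = p ^ m := by rw [← pow_add, Nat.add_sub_cancel' hβ]
    · calc p ^ α * t < p ^ α * p ^ (n - α) := Nat.mul_lt_mul_of_pos_left h.1.2 (pow_pos hp _)
        _ = p ^ n := by rw [← pow_add, Nat.add_sub_cancel' hα]
  · rintro ⟨s, t⟩ _ ⟨s', t'⟩ _ h
    simp only [Prod.mk.injEq] at h ⊢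
    exact ⟨Nat.eq_of_mul_eq_mul_left (pow_pos hp _) h.1,
      Nat.eq_of_mul_eq_mul_left (pow_pos hp _) h.2⟩
  · rintro ⟨s, t⟩ h
    simp only [mem_filter, mem_product, mem_range] at h
    obtain ⟨⟨hs, ht⟩, ⟨s, rfl⟩, ⟨t, rfl⟩, h⟩ := h
    refine ⟨(s, t), ?_, rfl⟩
    simp only [mem_filter, mem_product, mem_range]
    refine ⟨⟨?_, ?_⟩, (key s t).1 h⟩
    · refine lt_of_mul_lt_mul_left (a := p ^ β) ?_ (Nat.zero_le _)
      rwa [← pow_add, Nat.add_sub_cancel' hβ]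
    · refine lt_of_mul_lt_mul_left (a := p ^ α) ?_ (Nat.zero_le _)
      rwa [← pow_add, Nat.add_sub_cancel' hα]

/-- Induction on `r`, splitting on whether `p` divides the first factor. If it does, cancelling `p`
lowers `r` and `m` together while `n` stays; if not, the whole power must divide the second factor.
For `r = 0` the factor `r` kills the term with the possibly truncated exponent. -/
theorem card_filter_pow_dvd_mul {p : ℕ} (hp : p.Prime) {m n r : ℕ} (hm : r ≤ m) (hn : r ≤ n) :
    (((range (p ^ m) ×ˢ range (p ^ n)).filter fun x => p ^ r ∣ x.1 * x.2).card : ℤ) =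
      (r + 1) * (p : ℤ) ^ (m + n - r) - r * (p : ℤ) ^ (m + n - r - 1) := by
  induction r generalizing m with
  | zero => simp [pow_add]
  | succ r ih =>
    obtain ⟨m, rfl⟩ : ∃ k, m = k + 1 := ⟨m - 1, by omega⟩
    rw [← card_filter_add_card_filter_not (s := (range (p ^ (m + 1)) ×ˢ range (p ^ n)).filter
      fun x => p ^ (r + 1) ∣ x.1 * x.2) (fun x => p ∣ x.1), filter_filter, filter_filter]
    have h1 : ((range (p ^ (m + 1)) ×ˢ range (p ^ n)).filter fun x =>
        p ^ (r + 1) ∣ x.1 * x.2 ∧ p ∣ x.1).card =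
        ((range (p ^ m) ×ˢ range (p ^ n)).filter fun x => p ^ r ∣ x.1 * x.2).card := by
      have := card_filter_dvd_and_mul_dvd hp.pos (m := m + 1) (n := n) (α := 0) (β := 1)
        (by omega) (by omega) (r + 1)
      simp only [pow_one, pow_zero, one_dvd, true_and, Nat.sub_zero, Nat.add_sub_cancel] at this
      rw [← this]
      congr 1
      ext x
      simp [and_comm]
    have h2 : ((range (p ^ (m + 1)) ×ˢ range (p ^ n)).filter fun x =>
        p ^ (r + 1) ∣ x.1 * x.2 ∧ ¬ p ∣ x.1) =
        (range (p ^ (m + 1))).filter (¬ p ∣ ·) ×ˢ (range (p ^ n)).filter (p ^ (r + 1) ∣ ·) := by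
      ext ⟨s, t⟩
      simp only [mem_filter, mem_product, mem_range]
      constructor
      · rintro ⟨⟨hs, ht⟩, hd, hn⟩
        refine ⟨⟨hs, hn⟩, ht, ?_⟩
        exact (Nat.Coprime.pow_left _ ((Nat.Prime.coprime_iff_not_dvd hp).2 hn)).dvd_of_dvd_mul_left
          hd
      · rintro ⟨⟨hs, hn⟩, ht, hd⟩
        exact ⟨⟨hs, ht⟩, Dvd.dvd.mul_left hd _, hn⟩
    have h3 : (((range (p ^ (m + 1))).filter (¬ p ∣ ·)).card : ℤ) =
        (p : ℤ) ^ (m + 1) - (p : ℤ) ^ m := by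
      have e1 := card_filter_add_card_filter_not (s := range (p ^ (m + 1))) (p ∣ ·)
      have e2 := card_filter_pow_dvd_range_pow hp.pos (j := 1) (n := m + 1) (by omega)
      simp only [pow_one, Nat.add_sub_cancel] at e2
      rw [e2, card_range] at e1
      rw [eq_sub_iff_add_eq, add_comm]
      exact_mod_cast e1
    rw [h1, h2, card_product, Nat.cast_add, Nat.cast_mul, h3, card_filter_pow_dvd_range_pow hp.pos
      hn, ih (by omega) (by omega)]
    obtain ⟨j, rfl⟩ : ∃ j, m = r + j := ⟨m - r, by omega⟩
    obtain ⟨l, rfl⟩ : ∃ l, n = r + 1 + l := ⟨n - (r + 1), by omega⟩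
    have e1 : r + j + (r + 1 + l) - r = r + j + l + 1 := by omega
    have e2 : r + j + 1 + (r + 1 + l) - (r + 1) = r + j + l + 1 := by omega
    have e3 : r + 1 + l - (r + 1) = l := by omega
    rw [e1, e2, e3]
    simp only [Nat.add_sub_cancel]
    push_cast
    ring

theorem card_filter_pow_dvd_sub {p : ℕ} (hp : 0 < p) {j n : ℕ} (h : j ≤ n) (c : ℤ) :
    ((range (p ^ n)).filter fun w : ℕ => (p : ℤ) ^ j ∣ c - w).card = p ^ (n - j) := by
  have hpj : (0 : ℤ) < (p : ℤ) ^ j := by positivity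
  obtain ⟨v, hv⟩ := Int.eq_ofNat_of_zero_le (Int.emod_nonneg c hpj.ne')
  have hf : ((range (p ^ n)).filter fun w : ℕ => (p : ℤ) ^ j ∣ c - w) =
      (range (p ^ n)).filter fun w : ℕ => w ≡ v [MOD p ^ j] := by
    refine filter_congr fun w _ => ?_
    rw [← Int.modEq_iff_dvd, ← Int.natCast_modEq_iff, ← hv]
    push_cast
    exact ⟨fun h => h.trans (Int.mod_modEq _ _).symm, fun h => h.trans (Int.mod_modEq _ _)⟩
  rw [hf, ← Nat.count_eq_card_filter_range, Nat.count_modEq_card _ (pow_pos hp j)]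
  have e : p ^ n = p ^ j * p ^ (n - j) := by rw [← pow_add, Nat.add_sub_cancel' h]
  rw [e, Nat.mul_div_cancel_left _ (pow_pos hp j), Nat.mul_mod_right]
  simp

/-- The linear congruence `p^d w ≡ c` modulo `p^k` is solvable exactly when `gcd(p^d, p^k)` divides
`c`, and then determines `w` modulo `p^(k - d)`. The bound on `k` makes the range of `w` a union of
full periods. -/
theorem card_filter_pow_dvd_sub_pow_mul {p : ℕ} (hp : 0 < p) {k d n : ℕ} (h : k ≤ d + n) (c : ℕ) :
    ((range (p ^ n)).filter fun w : ℕ => (p : ℤ) ^ k ∣ (c : ℤ) - (p : ℤ) ^ d * w).card =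
      if p ^ min k d ∣ c then p ^ (n - (k - d)) else 0 := by
  rcases le_total k d with hkd | hkd
  · rw [min_eq_left hkd, Nat.sub_eq_zero_of_le hkd]
    have : ∀ w : ℕ, ((p : ℤ) ^ k ∣ (c : ℤ) - (p : ℤ) ^ d * w) ↔ p ^ k ∣ c := by
      intro w
      rw [dvd_sub_left (Dvd.dvd.mul_right (pow_dvd_pow _ hkd) _)]
      exact_mod_cast Int.natCast_dvd_natCast (m := p ^ k) (n := c)
    simp only [this]
    split_ifs with hc <;> simp [hc]
  · rw [min_eq_right hkd]
    split_ifs with hc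
    · obtain ⟨e, rfl⟩ := hc
      rw [← card_filter_pow_dvd_sub hp (j := k - d) (n := n) (by omega) e]
      congr 1
      refine filter_congr fun w _ => ?_
      have e1 : (p : ℤ) ^ k = (p : ℤ) ^ d * (p : ℤ) ^ (k - d) := by
        rw [← pow_add, Nat.add_sub_cancel' hkd]
      have e2 : ((p ^ d * e : ℕ) : ℤ) - (p : ℤ) ^ d * w = (p : ℤ) ^ d * ((e : ℤ) - w) := by
        push_cast; ring
      rw [e1, e2, mul_dvd_mul_iff_left (by positivity)]
    · rw [card_eq_zero, filter_eq_empty_iff]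
      intro w _ hw
      apply hc
      have h1 : (p : ℤ) ^ d ∣ (c : ℤ) := by
        have := (pow_dvd_pow (p : ℤ) hkd).trans hw
        rwa [dvd_sub_left (dvd_mul_right _ _)] at this
      exact_mod_cast h1

end Counting

/-! ### Polynomials in `p` as lists of terms. -/

section Terms

/-- The value at `q` of the polynomial with the list of terms `l`; the pair `(c, e)` stands for
the term `c * q ^ e`. -/
def evalTerms {R : Type*} [Ring R] (q : R) (l : List (ℤ × ℕ)) : R :=
  (l.map fun c => (c.1 : R) * q ^ c.2).sum

/-- The terms of the negative of a polynomial. -/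
def negTerms (l : List (ℤ × ℕ)) : List (ℤ × ℕ) := l.map fun c => (-c.1, c.2)

variable {R : Type*} [Ring R] (q : R)

@[simp]
theorem evalTerms_nil : evalTerms q [] = 0 := rfl

@[simp]
theorem evalTerms_cons (c : ℤ × ℕ) (l : List (ℤ × ℕ)) :
    evalTerms q (c :: l) = (c.1 : R) * q ^ c.2 + evalTerms q l := by
  simp [evalTerms]

@[simp]
theorem evalTerms_append (l l' : List (ℤ × ℕ)) :
    evalTerms q (l ++ l') = evalTerms q l + evalTerms q l' := by
  simp [evalTerms]

@[simp]
theorem evalTerms_negTerms (l : List (ℤ × ℕ)) : evalTerms q (negTerms l) = -evalTerms q l := by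
  induction l with
  | nil => simp [negTerms]
  | cons c l ih =>
    have : negTerms (c :: l) = (-c.1, c.2) :: negTerms l := rfl
    rw [this, evalTerms_cons, ih, evalTerms_cons]
    simp [add_comm]

theorem map_evalTerms {S : Type*} [Ring S] (f : R →+* S) (l : List (ℤ × ℕ)) :
    f (evalTerms q l) = evalTerms (f q) l := by
  induction l with
  | nil => simp
  | cons c l ih => simp [ih]

end Terms

/-! ### Counting reduced triangular matrices by the divisibility of their entries and minors. -/

/-- The upper triangular matrix with diagonal `p ^ d0, p ^ d1, p ^ d2` and the entries `u` above
the diagonal. -/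
def herm (p d0 d1 d2 : ℕ) (u : ℕ × ℕ × ℕ) : Matrix (Fin 3) (Fin 3) ℤ :=
  !![(p : ℤ) ^ d0, u.1, u.2.1; 0, (p : ℤ) ^ d1, u.2.2; 0, 0, (p : ℤ) ^ d2]

theorem det_herm (p d0 d1 d2 : ℕ) (u : ℕ × ℕ × ℕ) :
    (herm p d0 d1 d2 u).det = (p : ℤ) ^ (d0 + d1 + d2) := by
  simp [herm, Matrix.det_fin_three, pow_add]

/-- The entries above the diagonal of the reduced matrices with diagonal
`p ^ d0, p ^ d1, p ^ d2`. -/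
def residues (p d1 d2 : ℕ) : Finset (ℕ × ℕ × ℕ) :=
  Finset.range (p ^ d1) ×ˢ Finset.range (p ^ d2) ×ˢ Finset.range (p ^ d2)

theorem mem_residues {p d1 d2 : ℕ} {u : ℕ × ℕ × ℕ} :
    u ∈ residues p d1 d2 ↔ u.1 < p ^ d1 ∧ u.2.1 < p ^ d2 ∧ u.2.2 < p ^ d2 := by
  simp [residues]

/-- With `u = (s, w, t)`, the nonzero minors are, up to sign, the three products of two diagonal
entries, `s p^d2`, `t p^d0` and `s t - p^d1 w`. -/
theorem dvd_adjugate_herm_iff {p : ℕ} (hp : p.Prime) (d0 d1 d2 k : ℕ) (u : ℕ × ℕ × ℕ) :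
    (∀ i j, (p : ℤ) ^ k ∣ (herm p d0 d1 d2 u).adjugate i j) ↔
      (k ≤ d0 + d1 ∧ k ≤ d0 + d2 ∧ k ≤ d1 + d2) ∧ p ^ (k - d2) ∣ u.1 ∧ p ^ (k - d0) ∣ u.2.2 ∧
        (p : ℤ) ^ k ∣ ((u.1 * u.2.2 : ℕ) : ℤ) - (p : ℤ) ^ d1 * u.2.1 := by
  have hpow : ∀ i j : ℕ, (p : ℤ) ^ k ∣ (p : ℤ) ^ i * (p : ℤ) ^ j ↔ k ≤ i + j := by
    intro i j
    rw [← pow_add]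
    have := Nat.pow_dvd_pow_iff_le_right hp.one_lt (k := k) (l := i + j)
    exact_mod_cast this
  have hmul : ∀ (d v : ℕ), (p : ℤ) ^ k ∣ (p : ℤ) ^ d * v ↔ p ^ (k - d) ∣ v := by
    intro d v
    have : p ^ k ∣ p ^ d * v ↔ p ^ (k - d) ∣ v := by
      rcases le_total k d with h | h
      · simp [Nat.sub_eq_zero_of_le h, Dvd.dvd.mul_right (pow_dvd_pow p h) v]
      · conv_lhs => rw [← Nat.add_sub_cancel' h, pow_add]
        exact Nat.mul_dvd_mul_iff_left (pow_pos hp.pos _)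
    exact_mod_cast this
  rw [← hmul, ← hmul, ← hpow, ← hpow, ← hpow]
  have e3 : ((u.1 * u.2.2 : ℕ) : ℤ) - (p : ℤ) ^ d1 * u.2.1 = u.1 * u.2.2 - u.2.1 * (p : ℤ) ^ d1 := by
    push_cast; ring
  rw [e3]
  simp only [Fin.forall_fin_succ, herm, Matrix.adjugate_fin_three]
  simp [mul_comm]
  tauto

/-- The terms of the number of reduced matrices with diagonal `p ^ d0, p ^ d1, p ^ d2` whose
minors of order two are divisible by `p ^ k`, as a polynomial in `p`. -/
def minorTerms (d0 d1 d2 k : ℕ) : List (ℤ × ℕ) :=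
  if k ≤ d0 + d1 ∧ k ≤ d0 + d2 ∧ k ≤ d1 + d2 then
    -- After the forced powers `p^(k - d2)` of `s` and `p^(k - d0)` of `t` are divided out, `r` is
    -- the power of `p` still required of their product and `p^m` the number of remaining pairs. The
    -- exponent `d2 - (k - d1)` counts the solutions `w` for each pair.
    let r := min k d1 - (k - d0) - (k - d2)
    let m := (d1 - (k - d2)) + (d2 - (k - d0))
    [((r : ℤ) + 1, m - r + (d2 - (k - d1))), (-(r : ℤ), m - r - 1 + (d2 - (k - d1)))]
  else []

-- Project `(s, w, t)` to `(s, t)`: the image consists of the pairs for which the congruence for `w`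
-- is solvable, and all fibres have the same size. The pairs are then counted by
-- `card_filter_pow_dvd_mul`.
open Classical in
theorem card_filter_dvd_adjugate {p : ℕ} (hp : p.Prime) (d0 d1 d2 k : ℕ) :
    (((residues p d1 d2).filter fun u =>
      ∀ i j, (p : ℤ) ^ k ∣ (herm p d0 d1 d2 u).adjugate i j).card : ℤ) =
      evalTerms (p : ℤ) (minorTerms d0 d1 d2 k) := by
  simp only [dvd_adjugate_herm_iff hp, minorTerms]
  by_cases hk : k ≤ d0 + d1 ∧ k ≤ d0 + d2 ∧ k ≤ d1 + d2
  swap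
  · simp [hk]
  simp only [hk, true_and, if_true, and_self]
  set P := (Finset.range (p ^ d1) ×ˢ Finset.range (p ^ d2)).filter fun x =>
    p ^ (k - d2) ∣ x.1 ∧ p ^ (k - d0) ∣ x.2 ∧ p ^ min k d1 ∣ x.1 * x.2 with hP
  have h1 : ((residues p d1 d2).filter fun u =>
      p ^ (k - d2) ∣ u.1 ∧ p ^ (k - d0) ∣ u.2.2 ∧
        (p : ℤ) ^ k ∣ ((u.1 * u.2.2 : ℕ) : ℤ) - (p : ℤ) ^ d1 * u.2.1).card =
      P.card * p ^ (d2 - (k - d1)) := by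
    rw [Finset.card_eq_sum_card_fiberwise (f := fun u => (u.1, u.2.2)) (t := P)]
    · rw [← smul_eq_mul, ← Finset.sum_const]
      refine Finset.sum_congr rfl fun x hx => ?_
      rw [hP, Finset.mem_filter, Finset.mem_product, Finset.mem_range, Finset.mem_range] at hx
      have := card_filter_pow_dvd_sub_pow_mul hp.pos hk.2.2 (x.1 * x.2)
      rw [if_pos hx.2.2.2] at this
      rw [← this]
      refine Finset.card_bij (fun u _ => u.2.1) ?_ ?_ ?_
      · rintro ⟨s, w, t⟩ h
        simp only [Finset.mem_filter, mem_residues] at h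
        obtain ⟨⟨h, -, -, h'⟩, rfl⟩ := h
        exact Finset.mem_filter.2 ⟨Finset.mem_range.2 h.2.1, h'⟩
      · rintro ⟨s, w, t⟩ h ⟨s', w', t'⟩ h' e
        simp only [Finset.mem_filter] at h h'
        have := h.2.trans h'.2.symm
        simp only [Prod.mk.injEq] at this e ⊢
        tauto
      · intro w hw
        simp only [Finset.mem_filter, Finset.mem_range] at hw
        refine ⟨(x.1, w, x.2), ?_, rfl⟩
        simp only [Finset.mem_filter, mem_residues]
        tauto
    · rintro ⟨s, w, t⟩ h
      simp only [Finset.coe_filter, Set.mem_ofPred_eq, mem_residues] at h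
      simp only [hP, Finset.coe_filter, Set.mem_ofPred_eq, Finset.mem_product, Finset.mem_range]
      refine ⟨⟨h.1.1, h.1.2.2⟩, h.2.1, h.2.2.1, ?_⟩
      -- If `p^(min k d1)` did not divide `s t`, the congruence would have no solution, but `w` is
      -- one.
      have := card_filter_pow_dvd_sub_pow_mul hp.pos hk.2.2 (s * t)
      by_contra hc
      rw [if_neg hc, Finset.card_eq_zero, Finset.filter_eq_empty_iff] at this
      exact this (Finset.mem_range.2 h.1.2.1) h.2.2.2
  rw [h1, hP, card_filter_dvd_and_mul_dvd hp.pos (by omega) (by omega)]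
  push_cast
  rw [card_filter_pow_dvd_mul hp (by omega) (by omega)]
  simp only [evalTerms_cons, evalTerms_nil]
  push_cast
  ring

/-- The terms of the number of reduced matrices with diagonal `p ^ d0, p ^ d1, p ^ d2` whose
entries have greatest common divisor `1`, and whose minors of order two have greatest common
divisor `p ^ a`, as a polynomial in `p`. -/
def typeTerms (d0 d1 d2 a : ℕ) : List (ℤ × ℕ) :=
  minorTerms d0 d1 d2 a ++ negTerms (minorTerms d0 d1 d2 (a + 1)) ++
    if 1 ≤ d0 ∧ 1 ≤ d1 ∧ 1 ≤ d2 then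
      negTerms (minorTerms (d0 - 1) (d1 - 1) (d2 - 1) (a - 2)) ++
        minorTerms (d0 - 1) (d1 - 1) (d2 - 1) (a + 1 - 2)
    else []

theorem dvd_herm_iff {p : ℕ} (hp : p.Prime) (d0 d1 d2 : ℕ) (u : ℕ × ℕ × ℕ) :
    (∀ i j, (p : ℤ) ∣ herm p d0 d1 d2 u i j) ↔
      (1 ≤ d0 ∧ 1 ≤ d1 ∧ 1 ≤ d2) ∧ p ∣ u.1 ∧ p ∣ u.2.1 ∧ p ∣ u.2.2 := by
  have hpow : ∀ i : ℕ, (p : ℤ) ∣ (p : ℤ) ^ i ↔ 1 ≤ i := by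
    intro i
    have := Nat.pow_dvd_pow_iff_le_right hp.one_lt (k := 1) (l := i)
    rw [pow_one] at this
    exact_mod_cast this
  simp only [Fin.forall_fin_succ, herm]
  simp [hpow, Int.natCast_dvd_natCast]
  tauto

theorem herm_succ (p d0 d1 d2 s w t : ℕ) :
    herm p (d0 + 1) (d1 + 1) (d2 + 1) (p * s, p * w, p * t) =
      (p : ℤ) • herm p d0 d1 d2 (s, w, t) := by
  simp [herm, Matrix.smul_of, pow_succ']

-- Dividing the matrix by `p` lowers every diagonal exponent by one and divides the adjugate by
-- `p^2`, hence `k - 2`. For `k ≤ 2` the condition on the minors is automatic, in agreement with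
-- truncated subtraction.
open Classical in
theorem card_filter_dvd_and_dvd_adjugate {p : ℕ} (hp : p.Prime) (d0 d1 d2 k : ℕ) :
    (((residues p d1 d2).filter fun u => (∀ i j, (p : ℤ) ∣ herm p d0 d1 d2 u i j) ∧
      ∀ i j, (p : ℤ) ^ k ∣ (herm p d0 d1 d2 u).adjugate i j).card : ℤ) =
      if 1 ≤ d0 ∧ 1 ≤ d1 ∧ 1 ≤ d2 then
        evalTerms (p : ℤ) (minorTerms (d0 - 1) (d1 - 1) (d2 - 1) (k - 2)) else 0 := by
  split_ifs with hd
  swap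
  · rw [Nat.cast_eq_zero, Finset.card_eq_zero, Finset.filter_eq_empty_iff]
    intro u _ h
    exact hd ((dvd_herm_iff hp _ _ _ _).1 h.1).1
  obtain ⟨d0, rfl⟩ : ∃ d, d0 = d + 1 := ⟨d0 - 1, by omega⟩
  obtain ⟨d1, rfl⟩ : ∃ d, d1 = d + 1 := ⟨d1 - 1, by omega⟩
  obtain ⟨d2, rfl⟩ : ∃ d, d2 = d + 1 := ⟨d2 - 1, by omega⟩
  simp only [Nat.add_sub_cancel]
  rw [← card_filter_dvd_adjugate hp, Nat.cast_inj]
  have key : ∀ s w t : ℕ,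
      (∀ i j, (p : ℤ) ^ k ∣ (herm p (d0 + 1) (d1 + 1) (d2 + 1) (p * s, p * w, p * t)).adjugate i j)
      ↔ ∀ i j, (p : ℤ) ^ (k - 2) ∣ (herm p d0 d1 d2 (s, w, t)).adjugate i j := by
    intro s w t
    refine forall_congr' fun i => forall_congr' fun j => ?_
    rw [herm_succ, Matrix.adjugate_smul, Matrix.smul_apply, smul_eq_mul]
    simp only [Fintype.card_fin]
    have hp0 : (p : ℤ) ≠ 0 := by exact_mod_cast hp.ne_zero
    rcases le_total k 2 with h | h
    · simp [Nat.sub_eq_zero_of_le h, Dvd.dvd.mul_right (pow_dvd_pow (p : ℤ) h) _]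
    · conv_lhs => rw [← Nat.add_sub_cancel' h, pow_add]
      exact mul_dvd_mul_iff_left (pow_ne_zero _ hp0)
  have hlt : ∀ {v d : ℕ}, p * v < p ^ (d + 1) ↔ v < p ^ d := by
    intro v d
    rw [pow_succ']
    exact Nat.mul_lt_mul_left hp.pos
  symm
  refine Finset.card_bij (fun u _ => (p * u.1, p * u.2.1, p * u.2.2)) ?_ ?_ ?_
  · rintro ⟨s, w, t⟩ h
    simp only [Finset.mem_filter, mem_residues] at h ⊢
    refine ⟨?_, ?_, (key s w t).2 h.2⟩
    · simpa only [hlt] using h.1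
    · rw [dvd_herm_iff hp]
      simp
  · rintro ⟨s, w, t⟩ _ ⟨s', w', t'⟩ _ h
    simpa [hp.ne_zero] using h
  · rintro ⟨s, w, t⟩ h
    simp only [Finset.mem_filter, mem_residues, dvd_herm_iff hp] at h
    obtain ⟨h0, ⟨-, ⟨s, rfl⟩, ⟨w, rfl⟩, ⟨t, rfl⟩⟩, h2⟩ := h
    refine ⟨(s, w, t), ?_, rfl⟩
    simp only [Finset.mem_filter, mem_residues]
    exact ⟨by simpa only [hlt] using h0, (key s w t).1 h2⟩

/-- An integral matrix with entries prime to `p` as a whole and minors of order two with greatest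
common divisor of `p`-adic valuation `a`. -/
def HasType (p a : ℕ) (M : Matrix (Fin 3) (Fin 3) ℤ) : Prop :=
  ¬ (∀ i j, (p : ℤ) ∣ M i j) ∧ (∀ i j, (p : ℤ) ^ a ∣ M.adjugate i j) ∧
    ¬ ∀ i j, (p : ℤ) ^ (a + 1) ∣ M.adjugate i j

-- Inclusion-exclusion: from the matrices with minors divisible by `p^a` remove those with minors
-- divisible by `p^(a + 1)` and those divisible by `p`, and add back the ones removed twice.
open Classical in
theorem card_filter_hasType {p : ℕ} (hp : p.Prime) (d0 d1 d2 a : ℕ) :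
    (((residues p d1 d2).filter fun u => HasType p a (herm p d0 d1 d2 u)).card : ℤ) =
      evalTerms (p : ℤ) (typeTerms d0 d1 d2 a) := by
  have e : (((residues p d1 d2).filter fun u => HasType p a (herm p d0 d1 d2 u)).card : ℤ) =
      (((residues p d1 d2).filter fun u =>
        ∀ i j, (p : ℤ) ^ a ∣ (herm p d0 d1 d2 u).adjugate i j).card : ℤ) -
      (((residues p d1 d2).filter fun u =>
        ∀ i j, (p : ℤ) ^ (a + 1) ∣ (herm p d0 d1 d2 u).adjugate i j).card : ℤ) -
      (((residues p d1 d2).filter fun u => (∀ i j, (p : ℤ) ∣ herm p d0 d1 d2 u i j) ∧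
        ∀ i j, (p : ℤ) ^ a ∣ (herm p d0 d1 d2 u).adjugate i j).card : ℤ) +
      (((residues p d1 d2).filter fun u => (∀ i j, (p : ℤ) ∣ herm p d0 d1 d2 u i j) ∧
        ∀ i j, (p : ℤ) ^ (a + 1) ∣ (herm p d0 d1 d2 u).adjugate i j).card : ℤ) := by
    simp only [Finset.card_filter, Nat.cast_sum]
    rw [← Finset.sum_sub_distrib, ← Finset.sum_sub_distrib, ← Finset.sum_add_distrib]
    refine Finset.sum_congr rfl fun u _ => ?_
    have himp : (∀ i j, (p : ℤ) ^ (a + 1) ∣ (herm p d0 d1 d2 u).adjugate i j) →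
        ∀ i j, (p : ℤ) ^ a ∣ (herm p d0 d1 d2 u).adjugate i j :=
      fun h i j => (pow_dvd_pow _ (Nat.le_succ a)).trans (h i j)
    unfold HasType
    by_cases h1 : ∀ i j, (p : ℤ) ∣ herm p d0 d1 d2 u i j <;>
      by_cases h2 : ∀ i j, (p : ℤ) ^ (a + 1) ∣ (herm p d0 d1 d2 u).adjugate i j <;>
      by_cases h3 : ∀ i j, (p : ℤ) ^ a ∣ (herm p d0 d1 d2 u).adjugate i j <;>
      first
        | exact absurd (himp h2) h3
        | simp only [h1, h2, h3, and_true, not_true, not_false_iff, if_true, if_false,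
            and_self, and_false, implies_true]; simp
  rw [e, card_filter_dvd_adjugate hp, card_filter_dvd_adjugate hp,
    card_filter_dvd_and_dvd_adjugate hp, card_filter_dvd_and_dvd_adjugate hp, typeTerms]
  split_ifs <;> simp <;> ring

/-! ### Hermite and Smith normal forms over the integers. -/

section NormalForms

open Matrix

/-- The first row holds the Bézout coefficients of `a` and `b`, the second row `-b/g` and `a/g` with
`g` the gcd; a zero pair needs only the identity. -/
theorem exists_bezout_transform (a b : ℤ) :
    ∃ x y z w : ℤ, x * w - y * z = 1 ∧ z * a + w * b = 0 := by
  by_cases h : a = 0 ∧ b = 0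
  · exact ⟨1, 0, 0, 1, by norm_num, by simp [h.1, h.2]⟩
  have hg : (Int.gcd a b : ℤ) ≠ 0 := by
    rw [Ne, Nat.cast_eq_zero, Int.gcd_eq_zero_iff]; exact h
  obtain ⟨a', ha⟩ := Int.gcd_dvd_left a b
  obtain ⟨b', hb⟩ := Int.gcd_dvd_right a b
  refine ⟨Int.gcdA a b, Int.gcdB a b, -b', a', ?_, ?_⟩
  · have e := Int.gcd_eq_gcd_ab a b
    apply mul_left_cancel₀ hg
    calc (Int.gcd a b : ℤ) * (Int.gcdA a b * a' - Int.gcdB a b * -b')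
        = (Int.gcd a b * a') * Int.gcdA a b + (Int.gcd a b * b') * Int.gcdB a b := by ring
      _ = Int.gcd a b * 1 := by rw [← ha, ← hb, ← e, mul_one]
  · calc -b' * a + a' * b = -b' * (Int.gcd a b * a') + a' * (Int.gcd a b * b') := by
          rw [← ha, ← hb]
      _ = 0 := by ring

theorem exists_mul_upper (M : Matrix (Fin 3) (Fin 3) ℤ) :
    ∃ γ : GL (Fin 3) ℤ, ∀ i j, j < i → (γ.val * M) i j = 0 := by
  -- Elimination with the last two rows. It keeps every column in which both rows already vanish, so
  -- column 0 survives when column 1 is cleared.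
  have lower : ∀ M : Matrix (Fin 3) (Fin 3) ℤ, ∀ c : Fin 3, ∃ γ : GL (Fin 3) ℤ,
      (γ.val * M) 2 c = 0 ∧ ∀ j, M 1 j = 0 → M 2 j = 0 →
        (γ.val * M) 1 j = 0 ∧ (γ.val * M) 2 j = 0 := by
    intro M c
    obtain ⟨x, y, z, w, hdet, h⟩ := exists_bezout_transform (M 1 c) (M 2 c)
    refine ⟨GeneralLinearGroup.mk'' !![1, 0, 0; 0, x, y; 0, z, w] ?_, ?_, ?_⟩
    · simp [det_fin_three, hdet]
    · simpa [mul_apply, Fin.sum_univ_three] using h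
    · intro j h1 h2
      simp [mul_apply, Fin.sum_univ_three, h1, h2]
  have upper : ∀ M : Matrix (Fin 3) (Fin 3) ℤ, M 2 0 = 0 → ∃ γ : GL (Fin 3) ℤ,
      (γ.val * M) 1 0 = 0 ∧ (γ.val * M) 2 0 = 0 := by
    intro M h2
    obtain ⟨x, y, z, w, hdet, h⟩ := exists_bezout_transform (M 0 0) (M 1 0)
    refine ⟨GeneralLinearGroup.mk'' !![x, y, 0; z, w, 0; 0, 0, 1] ?_, ?_, ?_⟩
    · simp [det_fin_three, hdet]
    · simpa [mul_apply, Fin.sum_univ_three] using h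
    · simp [mul_apply, Fin.sum_univ_three, h2]
  obtain ⟨γ₁, h₁, -⟩ := lower M 0
  obtain ⟨γ₂, h₂, h₂'⟩ := upper _ h₁
  obtain ⟨γ₃, h₃, h₃'⟩ := lower (γ₂.val * (γ₁.val * M)) 1
  refine ⟨γ₃ * γ₂ * γ₁, fun i j hij => ?_⟩
  have e : (γ₃ * γ₂ * γ₁).val * M = γ₃.val * (γ₂.val * (γ₁.val * M)) := by
    simp [Units.val_mul, mul_assoc]
  rw [e]
  have h4 := h₃' 0 h₂ h₂'
  fin_cases i <;> fin_cases j <;> first | exact h₃ | exact h4.1 | exact h4.2 | simp at hij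

/-- Every integral matrix with determinant `± p ^ n` is a product of a unimodular matrix and a
reduced upper triangular matrix. -/
theorem exists_mul_eq_herm {p n : ℕ} (hp : p.Prime) (M : Matrix (Fin 3) (Fin 3) ℤ)
    (hM : M.det.natAbs = p ^ n) :
    ∃ (γ : GL (Fin 3) ℤ) (d0 d1 d2 : ℕ) (u : ℕ × ℕ × ℕ), d0 + d1 + d2 = n ∧
      u ∈ residues p d1 d2 ∧ γ.val * M = herm p d0 d1 d2 u := by
  obtain ⟨γ, hγ⟩ := exists_mul_upper M
  set T := γ.val * M with hT
  have hunit : (γ.val.det).natAbs = 1 :=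
    Int.isUnit_iff_natAbs_eq.1 ((Matrix.isUnit_iff_isUnit_det _).1 γ.isUnit)
  have hdet : (T 0 0).natAbs * (T 1 1).natAbs * (T 2 2).natAbs = p ^ n := by
    rw [← hM, ← Int.natAbs_mul, ← Int.natAbs_mul, ← one_mul M.det.natAbs, ← hunit,
      ← Int.natAbs_mul, ← det_mul, ← hT, det_fin_three, hγ 1 0 (by decide), hγ 2 0 (by decide),
      hγ 2 1 (by decide)]
    congr 1; ring
  have h0 : (T 0 0).natAbs ∣ p ^ n := ⟨_, by rw [← hdet, mul_assoc]⟩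
  have h1 : (T 1 1).natAbs ∣ p ^ n := ⟨(T 0 0).natAbs * (T 2 2).natAbs, by rw [← hdet]; ring⟩
  have h2 : (T 2 2).natAbs ∣ p ^ n := ⟨_, by rw [← hdet, mul_comm]⟩
  obtain ⟨d0, -, e0⟩ := (Nat.dvd_prime_pow hp).1 h0
  obtain ⟨d1, -, e1⟩ := (Nat.dvd_prime_pow hp).1 h1
  obtain ⟨d2, -, e2⟩ := (Nat.dvd_prime_pow hp).1 h2
  have hsum : d0 + d1 + d2 = n := by
    rw [e0, e1, e2, ← pow_add, ← pow_add] at hdet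
    exact Nat.pow_right_injective hp.two_le hdet
  have sign : ∀ {t : ℤ} {d : ℕ}, t.natAbs = p ^ d → ∃ s : ℤ, IsUnit s ∧ s * t = (p : ℤ) ^ d := by
    intro t d h
    rcases Int.natAbs_eq t with h' | h' <;> rw [h] at h'
    · exact ⟨1, isUnit_one, by rw [h']; simp⟩
    · exact ⟨-1, isUnit_one.neg, by rw [h']; simp⟩
  obtain ⟨s0, hs0, f0⟩ := sign e0
  obtain ⟨s1, hs1, f1⟩ := sign e1
  obtain ⟨s2, hs2, f2⟩ := sign e2
  have hpos : ∀ d : ℕ, (0 : ℤ) < (p : ℤ) ^ d := fun d => pow_pos (by exact_mod_cast hp.pos) d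
  have reduce : ∀ (v : ℤ) (d : ℕ), ∃ (k : ℤ) (r : ℕ), r < p ^ d ∧ v + k * (p : ℤ) ^ d = r := by
    intro v d
    refine ⟨-(v / (p : ℤ) ^ d), (v % (p : ℤ) ^ d).toNat, ?_, ?_⟩
    · zify
      rw [Int.toNat_of_nonneg (Int.emod_nonneg _ (hpos d).ne')]
      exact Int.emod_lt_of_pos _ (hpos d)
    · rw [Int.toNat_of_nonneg (Int.emod_nonneg _ (hpos d).ne'), Int.emod_def]; ring
  obtain ⟨k1, r1, hr1, q1⟩ := reduce (s0 * T 0 1) d1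
  obtain ⟨k3, r3, hr3, q3⟩ := reduce (s1 * T 1 2) d2
  -- The corner entry is reduced last, after the addition of `k1` times the middle row has changed
  -- it.
  obtain ⟨k2, r2, hr2, q2⟩ := reduce (s0 * T 0 2 + k1 * (s1 * T 1 2)) d2
  have hu : IsUnit (!![s0, k1 * s1, k2 * s2; 0, s1, k3 * s2; 0, 0, s2] :
      Matrix (Fin 3) (Fin 3) ℤ).det := by
    simpa [det_fin_three] using (hs0.mul hs1).mul hs2
  refine ⟨GeneralLinearGroup.mk'' _ hu * γ, d0, d1, d2, (r1, r2, r3), hsum,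
    mem_residues.2 ⟨hr1, hr2, hr3⟩, ?_⟩
  rw [Units.val_mul, mul_assoc, ← hT]
  ext i j
  have t10 := hγ 1 0 (by decide)
  have t20 := hγ 2 0 (by decide)
  have t21 := hγ 2 1 (by decide)
  fin_cases i <;> fin_cases j <;>
    simp [mul_apply, Fin.sum_univ_three, herm, t10, t20, t21, f0, f1, f2, mul_assoc]
  · rw [← q1]
  · rw [← q2]
  · rw [← q3]

/-- A nonsingular integral matrix can be made diagonal by unimodular matrices. -/
theorem exists_smith {n : Type*} [Fintype n] [DecidableEq n] (M : Matrix n n ℤ) (hM : M.det ≠ 0) :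
    ∃ (A B : GL n ℤ) (d : n → ℤ), A.val * M = diagonal d * B.val := by
  have hli : LinearIndependent ℤ M.row := Matrix.linearIndependent_rows_of_det_ne_zero hM
  set N := Submodule.span ℤ (Set.range M.row) with hN
  let bM : Module.Basis n ℤ N := Module.Basis.span hli
  have hrank : Module.finrank ℤ N = Module.finrank ℤ (n → ℤ) := by
    rw [Module.finrank_eq_card_basis bM, Module.finrank_fintype_fun_eq_card]
  -- The adapted basis `b'` of `ℤ^n` makes the multiples `d i • b' i` a basis `ab'` of the row
  -- lattice. `A` expresses `ab'` in the rows of `M`, and `B` has the vectors `b'` as rows; the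
  -- transposes occur because `toMatrix` stores coordinates in columns.
  obtain ⟨b', d, ab', h⟩ := Submodule.exists_smith_normal_form_of_rank_eq (Pi.basisFun ℤ n) hrank
  let A : GL n ℤ := ⟨(bM.toMatrix ab')ᵀ, (ab'.toMatrix bM)ᵀ,
    by rw [← transpose_mul, Module.Basis.toMatrix_mul_toMatrix_flip, transpose_one],
    by rw [← transpose_mul, Module.Basis.toMatrix_mul_toMatrix_flip, transpose_one]⟩
  let B : GL n ℤ := ⟨((Pi.basisFun ℤ n).toMatrix b')ᵀ, (b'.toMatrix (Pi.basisFun ℤ n))ᵀ,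
    by rw [← transpose_mul, Module.Basis.toMatrix_mul_toMatrix_flip, transpose_one],
    by rw [← transpose_mul, Module.Basis.toMatrix_mul_toMatrix_flip, transpose_one]⟩
  refine ⟨A, B, d, ?_⟩
  ext i j
  have h1 : (A.val * M) i j = (ab' i : n → ℤ) j := by
    have := congrArg (fun v : N => (v : n → ℤ) j) (bM.sum_toMatrix_smul_self ab' i)
    simp only [Submodule.coe_sum, Submodule.coe_smul, Finset.sum_apply, Pi.smul_apply] at this
    rw [← this, mul_apply]
    refine Finset.sum_congr rfl fun k _ => ?_
    have : (bM k : n → ℤ) = M.row k := by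
      rw [Module.Basis.span_apply]
    rw [this]
    rfl
  rw [h1, h i, diagonal_mul]
  simp [B, Module.Basis.toMatrix_apply]

end NormalForms

/-! ### Recognising the double coset by divisibility of entries and minors. -/

section ElementaryDivisors

open Matrix

theorem dvd_mul_mul_of_dvd {n : Type*} [Fintype n] {c : ℤ} {M : Matrix n n ℤ}
    (h : ∀ i j, c ∣ M i j) (A B : Matrix n n ℤ) (i j : n) : c ∣ (A * M * B) i j := by
  rw [mul_apply]
  refine Finset.dvd_sum fun k _ => Dvd.dvd.mul_right ?_ _
  rw [mul_apply]
  exact Finset.dvd_sum fun l _ => Dvd.dvd.mul_left (h _ _) _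

theorem forall_dvd_mul_mul_iff {n : Type*} [Fintype n] [DecidableEq n] (c : ℤ) (M : Matrix n n ℤ)
    (A B : GL n ℤ) : (∀ i j, c ∣ (A.val * M * B.val) i j) ↔ ∀ i j, c ∣ M i j := by
  refine ⟨fun h => ?_, fun h => dvd_mul_mul_of_dvd h _ _⟩
  have e : (A⁻¹).val * (A.val * M * B.val) * (B⁻¹).val = M := by
    rw [mul_assoc, mul_assoc (A.val * M), Units.mul_inv, mul_one, ← mul_assoc, Units.inv_mul,
      one_mul]
  rw [← e]
  exact dvd_mul_mul_of_dvd h _ _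

/-- The adjugate reverses products and preserves unimodularity, so this reduces to the invariance of
the entries' common divisors. -/
theorem forall_dvd_adjugate_mul_mul_iff {n : Type*} [Fintype n] [DecidableEq n] (c : ℤ)
    (M : Matrix n n ℤ) (A B : GL n ℤ) :
    (∀ i j, c ∣ (A.val * M * B.val).adjugate i j) ↔ ∀ i j, c ∣ M.adjugate i j := by
  have hadj : ∀ C : GL n ℤ, ∃ C' : GL n ℤ, C.val.adjugate = C'.val := fun C =>
    ⟨GeneralLinearGroup.mk'' C.val.adjugate (by
      rw [det_adjugate]; exact ((isUnit_iff_isUnit_det _).1 C.isUnit).pow _), rfl⟩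
  obtain ⟨A', hA⟩ := hadj A
  obtain ⟨B', hB⟩ := hadj B
  rw [adjugate_mul_distrib, adjugate_mul_distrib, hA, hB, ← mul_assoc, forall_dvd_mul_mul_iff]

theorem hasType_mul_mul_iff {p a : ℕ} (M : Matrix (Fin 3) (Fin 3) ℤ) (A B : GL (Fin 3) ℤ) :
    HasType p a (A.val * M * B.val) ↔ HasType p a M := by
  simp only [HasType, forall_dvd_mul_mul_iff, forall_dvd_adjugate_mul_mul_iff]

/-- For ordered exponents the gcd of the entries is `p^e0` and that of the minors of order two is
`p^(e0 + e1)`. -/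
theorem hasType_diagonal_iff {p : ℕ} (hp : p.Prime) {e0 e1 e2 : ℕ} (h01 : e0 ≤ e1) (h12 : e1 ≤ e2)
    (a : ℕ) :
    HasType p a (diagonal ![(p : ℤ) ^ e0, (p : ℤ) ^ e1, (p : ℤ) ^ e2]) ↔ e0 = 0 ∧ e1 = a := by
  have e : diagonal ![(p : ℤ) ^ e0, (p : ℤ) ^ e1, (p : ℤ) ^ e2] = herm p e0 e1 e2 (0, 0, 0) := by
    ext i j
    fin_cases i <;> fin_cases j <;> simp [herm]
  rw [e, HasType, dvd_herm_iff hp, dvd_adjugate_herm_iff hp, dvd_adjugate_herm_iff hp]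
  simp
  omega

/-- The elementary divisor theorem for integral matrices with determinant `± p ^ (a + b)`. -/
theorem hasType_iff {p a b : ℕ} (hp : p.Prime) (hab : a ≤ b) (M : Matrix (Fin 3) (Fin 3) ℤ)
    (hM : M.det.natAbs = p ^ (a + b)) :
    HasType p a M ↔ ∃ A B : GL (Fin 3) ℤ,
      M = A.val * diagonal ![(p : ℤ) ^ 0, (p : ℤ) ^ a, (p : ℤ) ^ b] * B.val := by
  constructor
  swap
  · rintro ⟨A, B, rfl⟩
    rw [hasType_mul_mul_iff, hasType_diagonal_iff hp (Nat.zero_le _) hab]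
    exact ⟨rfl, rfl⟩
  intro h
  have hunit : ∀ C : GL (Fin 3) ℤ, C.val.det.natAbs = 1 := fun C =>
    Int.isUnit_iff_natAbs_eq.1 ((isUnit_iff_isUnit_det _).1 C.isUnit)
  obtain ⟨A, B, d, hd⟩ := exists_smith M (by
    rw [← Int.natAbs_ne_zero, hM]; exact (pow_pos hp.pos _).ne')
  have hdet : ∏ i, (d i).natAbs = p ^ (a + b) := by
    have := congrArg (fun X : Matrix (Fin 3) (Fin 3) ℤ => X.det.natAbs) hd
    simp only [det_mul, Int.natAbs_mul, hunit, hM, one_mul, mul_one, det_diagonal] at this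
    rw [this, Fin.prod_univ_three, Fin.prod_univ_three, Int.natAbs_mul, Int.natAbs_mul]
  have hpow : ∀ i, ∃ e : ℕ, (d i).natAbs = p ^ e := fun i => by
    obtain ⟨e, -, he⟩ := (Nat.dvd_prime_pow hp).1
      (hdet ▸ Finset.dvd_prod_of_mem (fun i => (d i).natAbs) (Finset.mem_univ i))
    exact ⟨e, he⟩
  choose e he using hpow
  have hsign : ∀ i, ∃ s : ℤˣ, d i = s * (p : ℤ) ^ e i := fun i => by
    rcases Int.natAbs_eq (d i) with h' | h' <;> rw [he] at h'
    · exact ⟨1, by simp [h']⟩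
    · exact ⟨-1, by simp [h']⟩
  choose s hs using hsign
  -- The Smith form here carries no divisibility chain, so the exponents are sorted by a permutation
  -- matrix and the signs of the diagonal are absorbed into the left factor.
  set σ := Tuple.sort e with hσ
  have hmono : Monotone (e ∘ σ) := Tuple.monotone_sort e
  let P : GL (Fin 3) ℤ := ⟨σ.permMatrix ℤ, σ⁻¹.permMatrix ℤ,
    by rw [← Matrix.permMatrix_mul, inv_mul_cancel, Matrix.permMatrix_one],
    by rw [← Matrix.permMatrix_mul, mul_inv_cancel, Matrix.permMatrix_one]⟩
  let D : Matrix (Fin 3) (Fin 3) ℤ :=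
    diagonal ![(p : ℤ) ^ e (σ 0), (p : ℤ) ^ e (σ 1), (p : ℤ) ^ e (σ 2)]
  have hD : P.val * diagonal (fun i => (p : ℤ) ^ e i) = D * P.val := by
    have hDσ : D = diagonal fun i => (p : ℤ) ^ e (σ i) := by
      ext i j
      fin_cases i <;> fin_cases j <;> rfl
    ext i j
    rw [hDσ, mul_diagonal, diagonal_mul]
    by_cases hij : σ i = j
    · rw [← hij, mul_comm]
    · have : P.val i j = 0 := by simp [P, Equiv.Perm.permMatrix, PEquiv.toMatrix_apply, hij]
      rw [this, zero_mul, mul_zero]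
  have hM' : M = (A⁻¹ * diagGL s * P⁻¹).val * D * (P * B).val := by
    have h1 : diagonal d = (diagGL s).val * diagonal (fun i => (p : ℤ) ^ e i) := by
      simp only [diagGL, diagonal_mul_diagonal, ← hs]
    calc M = (A⁻¹).val * (A.val * M) := by rw [← mul_assoc, Units.inv_mul, one_mul]
      _ = (A⁻¹).val * (diagGL s).val * ((P⁻¹).val *
            (P.val * diagonal fun i => (p : ℤ) ^ e i)) * B.val := by
          rw [hd, h1, ← mul_assoc (P⁻¹).val, Units.inv_mul, one_mul]
          simp only [mul_assoc]
      _ = _ := by rw [hD]; simp only [Units.val_mul, mul_assoc]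
  have h01 : e (σ 0) ≤ e (σ 1) := hmono (by decide)
  have h12 : e (σ 1) ≤ e (σ 2) := hmono (by decide)
  rw [hM', hasType_mul_mul_iff, hasType_diagonal_iff hp h01 h12] at h
  have h2 : e (σ 2) = b := by
    have : e (σ 0) + e (σ 1) + e (σ 2) = a + b := by
      simp only [he] at hdet
      rw [Finset.prod_pow_eq_pow_sum, ← Equiv.sum_comp σ, Fin.sum_univ_three] at hdet
      exact Nat.pow_right_injective hp.two_le hdet
    omega
  refine ⟨A⁻¹ * diagGL s * P⁻¹, P * B, ?_⟩
  simp only [D, h.1, h.2, h2] at hM'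
  exact hM'

end ElementaryDivisors

/-! ### Reduced matrices as representatives of the cosets in a double coset. -/

section Cosets

open Matrix

theorem ω_t {n p : ℕ} [Fact p.Prime] (δ : Fin n → ℤ) :
    ω p (t p δ) = ∑ᶠ c ∈ cosets (HeckeCoset.mk (Lam n) (Lam n) (diagP p δ)), ωCoset p c := by
  rw [ω, t, Equiv.symm_apply_apply, Finsupp.sum_single_index (by simp)]
  simp

theorem Lam_le_Gp (n p : ℕ) : Lam n ≤ Gp n p := by
  rintro _ ⟨γ, rfl⟩
  refine ⟨GeneralLinearGroup.map (Int.castRingHom (zInv p)) γ, ?_⟩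
  ext i j
  simp

theorem mem_cosets_mk {n p : ℕ} {d : (Gp n p).toSubmonoid} {c : Coset n} :
    c ∈ cosets (HeckeCoset.mk (Lam n) (Lam n) d) ↔
      ∃ h ∈ Lam n, ∃ k ∈ Lam n, Coset.mk (h * d.1 * k) = c := by
  have hrel : ∀ g : (Gp n p).toSubmonoid,
      HeckeCoset.mk (Lam n) (Lam n) g = HeckeCoset.mk (Lam n) (Lam n) d ↔
        ∃ h ∈ Lam n, ∃ k ∈ Lam n, g.1 = h * d.1 * k := by
    intro g
    rw [eq_comm]
    refine (Quotient.eq (r := HeckeCoset.setoid (Gp n p).toSubmonoid (Lam n) (Lam n))).trans ?_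
    exact DoubleCoset.rel_iff
  constructor
  · rintro ⟨g, hg, rfl⟩
    obtain ⟨h, hh, k, hk, e⟩ := (hrel g).1 hg
    exact ⟨h, hh, k, hk, by rw [e]⟩
  · rintro ⟨h, hh, k, hk, rfl⟩
    exact ⟨⟨h * d.1 * k, (Gp n p).mul_mem ((Gp n p).mul_mem (Lam_le_Gp n p hh) d.2)
      (Lam_le_Gp n p hk)⟩, (hrel _).2 ⟨h, hh, k, hk, rfl⟩, rfl⟩

theorem ωCoset_eq {n p : ℕ} (hp : p.Prime) {c : Coset n} {δ : Fin n → ℤ} (h : HasDiag p c δ) :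
    ωCoset p c = ∏ i : Fin n, (x i / (p : RatFun n) ^ ((i : ℕ) + 1)) ^ δ i := by
  have hex : ∃ δ : Fin n → ℤ, HasDiag p c δ := ⟨δ, h⟩
  rw [ωCoset, dif_pos hex, hex.choose_spec.unique hp h]

theorem Coset.mk_eq_mk_iff {n : ℕ} {g g' : GL (Fin n) ℚ} :
    Coset.mk g = Coset.mk g' ↔ ∃ γ : GL (Fin n) ℤ,
      g'.val = (γ.val.map (Int.castRingHom ℚ)) * g.val := by
  rw [Coset.mk, Coset.mk, Quotient.eq, QuotientGroup.rightRel_apply]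
  constructor
  · rintro ⟨γ, hγ⟩
    refine ⟨γ, ?_⟩
    have : g' = GeneralLinearGroup.map (Int.castRingHom ℚ) γ * g := by rw [hγ]; simp
    rw [this]
    rfl
  · rintro ⟨γ, hγ⟩
    refine ⟨γ, ?_⟩
    rw [eq_mul_inv_iff_mul_eq]
    exact Units.ext hγ.symm

/-- The reduced upper triangular matrix with diagonal `p ^ m 0, p ^ m 1, p ^ m 2` and the entries
`u` above the diagonal, as an element of `GL_3(ℚ)`. -/
noncomputable def hermGL (p : ℕ) [hp : Fact p.Prime] (m : Fin 3 → ℕ) (u : ℕ × ℕ × ℕ) : GL (Fin 3) ℚ :=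
  GeneralLinearGroup.mkOfDetNeZero
    ((herm p (m 0) (m 1) (m 2) u).map (Int.castRingHom ℚ)) (by
      rw [← RingHom.mapMatrix_apply, ← RingHom.map_det, det_herm]
      have : (p : ℚ) ≠ 0 := Nat.cast_ne_zero.2 hp.out.ne_zero
      simp [this])

theorem val_hermGL (p : ℕ) [Fact p.Prime] (m : Fin 3 → ℕ) (u : ℕ × ℕ × ℕ) :
    (hermGL p m u).val = (herm p (m 0) (m 1) (m 2) u).map (Int.castRingHom ℚ) := rfl

theorem hasDiag_hermGL (p : ℕ) [Fact p.Prime] (m : Fin 3 → ℕ) (u : ℕ × ℕ × ℕ) :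
    HasDiag p (Coset.mk (hermGL p m u)) fun i => (m i : ℤ) := by
  refine ⟨_, rfl, fun i j hij => ?_, fun i => ?_⟩
  · rw [val_hermGL]
    fin_cases i <;> fin_cases j <;> simp [herm] at hij ⊢
  · rw [val_hermGL]
    fin_cases i <;> simp [herm]

/-- The first two columns force the diagonal entries `γ 0 0` and `γ 1 1` to be 1 and `γ 1 0` to be
0. The entries next to the diagonal then agree modulo the bounds of their ranges, hence agree; this
gives `γ 0 1 = 0`, after which the corner entries are congruent too. -/
theorem eq_of_mul_herm_eq_herm {p d0 d1 d2 : ℕ} (hp : p.Prime) {u v : ℕ × ℕ × ℕ}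
    (hu : u ∈ residues p d1 d2) (hv : v ∈ residues p d1 d2) (γ : Matrix (Fin 3) (Fin 3) ℤ)
    (h : γ * herm p d0 d1 d2 u = herm p d0 d1 d2 v) : u = v := by
  obtain ⟨s, w, t⟩ := u
  obtain ⟨s', w', t'⟩ := v
  rw [mem_residues] at hu hv
  have hpos : ∀ d : ℕ, (p : ℤ) ^ d ≠ 0 := fun d => pow_ne_zero _ (by exact_mod_cast hp.ne_zero)
  have key : ∀ (i j : Fin 3), γ i 0 * herm p d0 d1 d2 (s, w, t) 0 j +
      γ i 1 * herm p d0 d1 d2 (s, w, t) 1 j + γ i 2 * herm p d0 d1 d2 (s, w, t) 2 j =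
      herm p d0 d1 d2 (s', w', t') i j := by
    intro i j
    rw [← h, mul_apply, Fin.sum_univ_three]
  have k00 := key 0 0
  have k10 := key 1 0
  have k01 := key 0 1
  have k11 := key 1 1
  have k02 := key 0 2
  have k12 := key 1 2
  simp [herm, hp.ne_zero] at k00 k10 k01 k11 k02 k12
  rw [k00] at k01 k02
  rw [k10] at k11 k12
  simp [hp.ne_zero] at k11
  rw [k11] at k12
  have red : ∀ {d y y' : ℕ} {c : ℤ}, y < p ^ d → y' < p ^ d → (y : ℤ) + c * (p : ℤ) ^ d = y' →
      y = y' := by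
    intro d y y' c hy hy' e
    have : (y : ℤ) ≡ y' [ZMOD ((p ^ d : ℕ) : ℤ)] := by
      rw [← e, Int.modEq_iff_dvd]
      exact ⟨c, by push_cast; ring⟩
    have := (Int.natCast_modEq_iff).1 this
    exact Nat.ModEq.eq_of_lt_of_lt this hy hy'
  have e1 : s = s' := red hu.1 hv.1 (c := γ 0 1) (by linarith)
  have e3 : t = t' := red hu.2.2 hv.2.2 (c := γ 1 2) (by linarith)
  have hγ01 : γ 0 1 = 0 := by
    rw [e1] at k01
    have : γ 0 1 * (p : ℤ) ^ d1 = 0 := by linarith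
    exact (mul_eq_zero.1 this).resolve_right (hpos _)
  rw [hγ01] at k02
  have e2 : w = w' := red hu.2.1 hv.2.1 (c := γ 0 2) (by linarith)
  rw [e1, e2, e3]

theorem val_diagP (p : ℕ) [Fact p.Prime] (a b : ℕ) :
    (diagP p ![0, (a : ℤ), (b : ℤ)]).1.val =
      (diagonal ![(p : ℤ) ^ 0, (p : ℤ) ^ a, (p : ℤ) ^ b]).map (Int.castRingHom ℚ) := by
  ext i j
  fin_cases i <;> fin_cases j <;> simp [diagP, diagGL, pUnit]

open Classical in
/-- The reduced upper triangular matrices in the double coset of `diag(1, p ^ a, p ^ b)`. -/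
noncomputable def hermReps (p a b : ℕ) : Finset (Σ _ : Fin 3 → ℕ, ℕ × ℕ × ℕ) :=
  (Finset.Nat.antidiagonalTuple 3 (a + b)).sigma fun m =>
    (residues p (m 1) (m 2)).filter fun u => HasType p a (herm p (m 0) (m 1) (m 2) u)

open Classical in
theorem mem_hermReps {p a b : ℕ} {r : Σ _ : Fin 3 → ℕ, ℕ × ℕ × ℕ} :
    r ∈ hermReps p a b ↔ r.1 0 + r.1 1 + r.1 2 = a + b ∧ r.2 ∈ residues p (r.1 1) (r.1 2) ∧
      HasType p a (herm p (r.1 0) (r.1 1) (r.1 2) r.2) := by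
  rw [hermReps, Finset.mem_sigma, Finset.Nat.mem_antidiagonalTuple, Finset.mem_filter,
    Fin.sum_univ_three]

/-- The elementary divisor criterion puts the reduced matrices in the double coset. Injectivity
combines uniqueness of the diagonal with uniqueness of the reduced entries; surjectivity is Hermite
reduction of the integral matrix `A * diag * B`. -/
theorem bijOn_hermReps (p : ℕ) [hp : Fact p.Prime] {a b : ℕ} (hab : a ≤ b) :
    Set.BijOn (fun r : Σ _ : Fin 3 → ℕ, ℕ × ℕ × ℕ => Coset.mk (hermGL p r.1 r.2))
      (hermReps p a b)
      (cosets (HeckeCoset.mk (Lam 3) (Lam 3) (diagP p ![0, (a : ℤ), (b : ℤ)]))) := by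
  have hinj : Function.Injective fun M : Matrix (Fin 3) (Fin 3) ℤ =>
      M.map (Int.castRingHom ℚ) := Matrix.map_injective Int.cast_injective
  refine ⟨?_, ?_, ?_⟩
  · rintro ⟨m, u⟩ hr
    obtain ⟨hsum, -, hT⟩ := mem_hermReps.1 (Finset.mem_coe.1 hr)
    obtain ⟨A, B, hAB⟩ := (hasType_iff hp.out hab _ (by
      rw [det_herm, hsum, Int.natAbs_pow, Int.natAbs_natCast])).1 hT
    refine mem_cosets_mk.2 ⟨_, ⟨A, rfl⟩, _, ⟨B, rfl⟩, ?_⟩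
    congr 1
    apply Units.ext
    rw [val_hermGL, hAB, Units.val_mul, Units.val_mul, val_diagP, Matrix.map_mul, Matrix.map_mul]
    rfl
  · rintro ⟨m, u⟩ hr ⟨m', u'⟩ hr' h
    obtain ⟨-, hu, -⟩ := mem_hermReps.1 (Finset.mem_coe.1 hr)
    obtain ⟨-, hu', -⟩ := mem_hermReps.1 (Finset.mem_coe.1 hr')
    simp only at h hu hu'
    have hm : m = m' := by
      have := (hasDiag_hermGL p m u).unique hp.out (h ▸ hasDiag_hermGL p m' u')
      funext i
      exact_mod_cast congrFun this i
    subst hm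
    obtain ⟨γ, hγ⟩ := Coset.mk_eq_mk_iff.1 h
    rw [val_hermGL, val_hermGL, ← Matrix.map_mul] at hγ
    rw [eq_of_mul_herm_eq_herm hp.out hu hu' γ.val (hinj hγ).symm]
  · intro c hc
    obtain ⟨_, ⟨A, rfl⟩, _, ⟨B, rfl⟩, rfl⟩ := mem_cosets_mk.1 hc
    set M := A.val * diagonal ![(p : ℤ) ^ 0, (p : ℤ) ^ a, (p : ℤ) ^ b] * B.val with hM
    have hunit : ∀ C : GL (Fin 3) ℤ, C.val.det.natAbs = 1 := fun C =>
      Int.isUnit_iff_natAbs_eq.1 ((isUnit_iff_isUnit_det _).1 C.isUnit)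
    have hdet : M.det.natAbs = p ^ (a + b) := by
      rw [hM, det_mul, det_mul, Int.natAbs_mul, Int.natAbs_mul, hunit, hunit, det_diagonal,
        Fin.prod_univ_three]
      simp [Int.natAbs_mul, Int.natAbs_pow, pow_add]
    obtain ⟨γ, d0, d1, d2, u, hsum, hu, hγ⟩ := exists_mul_eq_herm hp.out M hdet
    refine ⟨⟨![d0, d1, d2], u⟩, ?_, ?_⟩
    · refine Finset.mem_coe.2 (mem_hermReps.2 ⟨hsum, hu, ?_⟩)
      change HasType p a (herm p d0 d1 d2 u)
      -- A right factor 1 is inserted so that two-sided invariance applies.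
      rw [← hγ, ← mul_one (γ.val * M), ← Units.val_one, hasType_mul_mul_iff,
        hasType_iff hp.out hab M hdet]
      exact ⟨A, B, hM⟩
    · refine (Coset.mk_eq_mk_iff.2 ⟨γ, ?_⟩).symm
      rw [val_hermGL]
      change (herm p d0 d1 d2 u).map _ = _
      rw [← hγ, hM, Matrix.map_mul, Matrix.map_mul, Matrix.map_mul, ← val_diagP]
      rfl

/-- The spherical map on `t(1, p ^ a, p ^ b)`, as a sum over the diagonals of the reduced
matrices. -/
theorem ω_t_eq_sum (p : ℕ) [hp : Fact p.Prime] {a b : ℕ} (hab : a ≤ b) :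
    ω p (t p ![0, (a : ℤ), (b : ℤ)]) =
      ∑ m ∈ Finset.Nat.antidiagonalTuple 3 (a + b),
        evalTerms (p : RatFun 3) (typeTerms (m 0) (m 1) (m 2) a) *
          ∏ i : Fin 3, (x i / (p : RatFun 3) ^ ((i : ℕ) + 1)) ^ m i := by
  rw [ω_t, ← finsum_mem_eq_of_bijOn
    (f := fun r => ∏ i : Fin 3, (x i / (p : RatFun 3) ^ ((i : ℕ) + 1)) ^ r.1 i) _
    (bijOn_hermReps p hab), finsum_mem_coe_finset, hermReps, Finset.sum_sigma]
  · refine Finset.sum_congr rfl fun m _ => ?_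
    simp only [Finset.sum_const, nsmul_eq_mul]
    congr 1
    have := congrArg (Int.castRingHom (RatFun 3)) (card_filter_hasType hp.out (m 0) (m 1) (m 2) a)
    rw [map_evalTerms] at this
    simpa using this
  · rintro ⟨m, u⟩ _
    rw [ωCoset_eq hp.out (hasDiag_hermGL p m u)]
    simp

end Cosets

/-! ### Reduction of the table to integer arithmetic. -/

section Expansion

/-- The coefficient of the `e`-th power in a polynomial given by a list of terms. -/
def coeffTerms (l : List (ℤ × ℕ)) (e : ℕ) : ℤ := (l.map fun c => if c.2 = e then c.1 else 0).sum

/-- Whether all coefficients of a polynomial given by a list of terms vanish. -/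
def vanishes (l : List (ℤ × ℕ)) : Bool := l.all fun c => coeffTerms l c.2 == 0

/-- The terms of the product of a polynomial and the `k`-th power of the variable. -/
def shiftTerms (k : ℕ) (l : List (ℤ × ℕ)) : List (ℤ × ℕ) := l.map fun c => (c.1, c.2 + k)

theorem evalTerms_eq_sum_coeffTerms {R : Type*} [Ring R] (q : R) (S : Finset ℕ)
    (l : List (ℤ × ℕ)) (h : ∀ c ∈ l, c.2 ∈ S) :
    evalTerms q l = ∑ e ∈ S, (coeffTerms l e : R) * q ^ e := by
  induction l with
  | nil => simp [coeffTerms]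
  | cons c l ih =>
    have hc : ∀ e, coeffTerms (c :: l) e = (if c.2 = e then c.1 else 0) + coeffTerms l e :=
      fun e => by simp [coeffTerms]
    rw [evalTerms_cons, ih fun c' hc' => h c' (List.mem_cons_of_mem _ hc')]
    simp only [hc, Int.cast_add, add_mul, Finset.sum_add_distrib]
    congr 1
    rw [Finset.sum_eq_single c.2]
    · simp
    · intro e _ he
      simp [he.symm]
    · intro h'
      exact absurd (h c List.mem_cons_self) h'

/-- Only exponents occurring in the list can have a nonzero coefficient, so the test made by
`vanishes` is enough. -/
theorem evalTerms_eq_zero_of_vanishes {R : Type*} [Ring R] (q : R) {l : List (ℤ × ℕ)}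
    (h : vanishes l = true) : evalTerms q l = 0 := by
  rw [evalTerms_eq_sum_coeffTerms q (l.map Prod.snd).toFinset l
    fun c hc => List.mem_toFinset.2 (List.mem_map_of_mem hc)]
  refine Finset.sum_eq_zero fun e he => ?_
  obtain ⟨c, hc, rfl⟩ := List.mem_map.1 (List.mem_toFinset.1 he)
  have := List.all_eq_true.1 h c hc
  rw [beq_iff_eq.1 this]
  simp

theorem evalTerms_shiftTerms {R : Type*} [CommRing R] (q : R) (k : ℕ) (l : List (ℤ × ℕ)) :
    evalTerms q (shiftTerms k l) = evalTerms q l * q ^ k := by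
  induction l with
  | nil => simp [shiftTerms]
  | cons c l ih =>
    have : shiftTerms k (c :: l) = (c.1, c.2 + k) :: shiftTerms k l := rfl
    rw [this, evalTerms_cons, ih, evalTerms_cons]
    ring

/-- Whether `(d0, d1, d2)` is a permutation of `(i, j, k)`. -/
def isPerm (i j k d0 d1 d2 : ℕ) : Bool :=
  (d0 == i && ((d1 == j && d2 == k) || (d1 == k && d2 == j))) ||
  (d0 == j && ((d1 == i && d2 == k) || (d1 == k && d2 == i))) ||
  (d0 == k && ((d1 == i && d2 == j) || (d1 == j && d2 == i)))

theorem mem_image_perm_iff (i j k : ℕ) (m : Fin 3 → ℕ) :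
    m ∈ ((Finset.univ : Finset (Equiv.Perm (Fin 3))).image fun σ l => ![i, j, k] (σ l)) ↔
      isPerm i j k (m 0) (m 1) (m 2) = true := by
  have hu : (Finset.univ : Finset (Equiv.Perm (Fin 3))) =
      {1, Equiv.swap 0 1, Equiv.swap 0 2, Equiv.swap 1 2, Equiv.swap 0 1 * Equiv.swap 1 2,
        Equiv.swap 1 2 * Equiv.swap 0 1} := by decide
  have e1 : ∀ l : Fin 3, (Equiv.swap 0 1 : Equiv.Perm (Fin 3)) l = ![1, 0, 2] l := by decide
  have e2 : ∀ l : Fin 3, (Equiv.swap 0 2 : Equiv.Perm (Fin 3)) l = ![2, 1, 0] l := by decide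
  have e3 : ∀ l : Fin 3, (Equiv.swap 1 2 : Equiv.Perm (Fin 3)) l = ![0, 2, 1] l := by decide
  simp only [hu, Finset.image_insert, Finset.image_singleton, Finset.mem_insert,
    Finset.mem_singleton, funext_iff, Fin.forall_fin_succ, isPerm]
  simp [e1, e2, e3]
  tauto

/-- Summing an indicator over exponent vectors counts each monomial once, even when indices
coincide, and uses the index set of `ω_t_eq_sum`. -/
theorem sym_eq_sum {i j k n : ℕ} (h : i + j + k = n) :
    sym i j k = ∑ m ∈ Finset.Nat.antidiagonalTuple 3 n,
      if isPerm i j k (m 0) (m 1) (m 2) then ∏ l : Fin 3, x l ^ m l else 0 := by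
  rw [sym, ← Finset.sum_filter]
  refine Finset.sum_congr ?_ fun _ _ => rfl
  ext m
  rw [mem_image_perm_iff, Finset.mem_filter, Finset.Nat.mem_antidiagonalTuple, Fin.sum_univ_three]
  refine ⟨fun hm => ⟨?_, hm⟩, fun hm => hm.2⟩
  simp only [isPerm, Bool.or_eq_true, Bool.and_eq_true, beq_iff_eq] at hm
  omega

theorem sym_zero : sym 0 0 0 = 1 := by
  rw [sym_eq_sum (n := 0) rfl, Finset.Nat.antidiagonalTuple_zero_right]
  simp [isPerm]

/-- A linear combination of monomial symmetric polynomials: the entry `(c, (i, j, k), e)` stands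
for `c(p) * sym i j k / p ^ e`, with `c` a polynomial given by a list of terms. -/
noncomputable def symComb (p : ℕ) (T : List (List (ℤ × ℕ) × (ℕ × ℕ × ℕ) × ℕ)) : RatFun 3 :=
  (T.map fun r => evalTerms (p : RatFun 3) r.1 * sym r.2.1.1 r.2.1.2.1 r.2.1.2.2 /
    (p : RatFun 3) ^ r.2.2).sum

/-- The terms of the coefficient of `x_1 ^ d0 * x_2 ^ d1 * x_3 ^ d2` in a linear combination of
monomial symmetric polynomials, multiplied by the `k`-th power of `p`. -/
def combTerms (k d0 d1 d2 : ℕ) (T : List (List (ℤ × ℕ) × (ℕ × ℕ × ℕ) × ℕ)) : List (ℤ × ℕ) :=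
  T.flatMap fun r => if isPerm r.2.1.1 r.2.1.2.1 r.2.1.2.2 d0 d1 d2 then
    shiftTerms (k - r.2.2) r.1 else []

/-- Whether the coefficients of `ω(t(1, p ^ a, p ^ b))`, where `a + b = n`, are those of a linear
combination of monomial symmetric polynomials of degree `n`. -/
def checkComb (a n : ℕ) (T : List (List (ℤ × ℕ) × (ℕ × ℕ × ℕ) × ℕ)) : Bool :=
  (T.all fun r => r.2.1.1 + r.2.1.2.1 + r.2.1.2.2 == n && r.2.2 ≤ 3 * n) &&
  (List.range (n + 1)).all fun d0 => (List.range (n + 1 - d0)).all fun d1 =>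
    -- The factors `p^{-i}` contribute `p^{-(d0 + 2 d1 + 3 d2)}` with `d2 = n - d0 - d1`. This
    -- weight is at most `3 n`, so `p^(3 n)` clears all denominators.
    vanishes (shiftTerms (3 * n - (d0 + 2 * d1 + 3 * (n - d0 - d1)))
        (typeTerms d0 d1 (n - d0 - d1) a) ++
      negTerms (combTerms (3 * n) d0 d1 (n - d0 - d1) T))

theorem natCast_ratFun_ne_zero {n p : ℕ} (hp : p ≠ 0) : (p : RatFun n) ≠ 0 := by
  have h := (IsFractionRing.injective (MvPolynomial (Fin n) ℚ) (RatFun n)).ne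
    (Nat.cast_ne_zero.2 hp : (p : MvPolynomial (Fin n) ℚ) ≠ 0)
  simpa using h

theorem symComb_eq_sum {p : ℕ} (hp : p ≠ 0) (n : ℕ) (T : List (List (ℤ × ℕ) × (ℕ × ℕ × ℕ) × ℕ))
    (hT : ∀ r ∈ T, r.2.1.1 + r.2.1.2.1 + r.2.1.2.2 = n ∧ r.2.2 ≤ 3 * n) :
    symComb p T = ∑ m ∈ Finset.Nat.antidiagonalTuple 3 n,
      evalTerms (p : RatFun 3) (combTerms (3 * n) (m 0) (m 1) (m 2) T) / (p : RatFun 3) ^ (3 * n) *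
        ∏ l : Fin 3, x l ^ m l := by
  have hp' : (p : RatFun 3) ≠ 0 := natCast_ratFun_ne_zero hp
  induction T with
  | nil => simp [symComb, combTerms]
  | cons r T ih =>
    have e1 : symComb p (r :: T) = evalTerms (p : RatFun 3) r.1 *
        sym r.2.1.1 r.2.1.2.1 r.2.1.2.2 / (p : RatFun 3) ^ r.2.2 + symComb p T := by
      simp [symComb]
    obtain ⟨hr, he⟩ := hT r List.mem_cons_self
    rw [e1, ih fun r' hr' => hT r' (List.mem_cons_of_mem _ hr'), sym_eq_sum hr, Finset.mul_sum,
      Finset.sum_div, ← Finset.sum_add_distrib]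
    refine Finset.sum_congr rfl fun m _ => ?_
    have e2 : combTerms (3 * n) (m 0) (m 1) (m 2) (r :: T) =
        (if isPerm r.2.1.1 r.2.1.2.1 r.2.1.2.2 (m 0) (m 1) (m 2) then
          shiftTerms (3 * n - r.2.2) r.1 else []) ++ combTerms (3 * n) (m 0) (m 1) (m 2) T := by
      simp [combTerms]
    rw [e2, evalTerms_append, add_div, add_mul]
    congr 1
    split_ifs with h
    · rw [evalTerms_shiftTerms]
      have : (p : RatFun 3) ^ (3 * n) = (p : RatFun 3) ^ (3 * n - r.2.2) *
          (p : RatFun 3) ^ r.2.2 := by rw [← pow_add, Nat.sub_add_cancel he]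
      rw [this]
      field_simp
    · simp

/-- Both sides are sums over the same exponent vectors, and after multiplication by `p^(3 n)`, with
`n = a + b`, the check equates their coefficients as polynomials in `p`. -/
theorem ω_t_eq_symComb (p : ℕ) [hp : Fact p.Prime] {a b : ℕ} (hab : a ≤ b)
    (T : List (List (ℤ × ℕ) × (ℕ × ℕ × ℕ) × ℕ)) (h : checkComb a (a + b) T = true) :
    ω p (t p ![0, (a : ℤ), (b : ℤ)]) = symComb p T := by
  rw [checkComb, Bool.and_eq_true, List.all_eq_true, List.all_eq_true] at h
  have hp' : (p : RatFun 3) ≠ 0 := natCast_ratFun_ne_zero hp.out.ne_zero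
  rw [ω_t_eq_sum p hab, symComb_eq_sum hp.out.ne_zero (a + b) T fun r hr => by
    simpa only [Bool.and_eq_true, beq_iff_eq, decide_eq_true_eq] using h.1 r hr]
  refine Finset.sum_congr rfl fun m hm => ?_
  rw [Finset.Nat.mem_antidiagonalTuple, Fin.sum_univ_three] at hm
  have hv := List.all_eq_true.1 (h.2 (m 0) (List.mem_range.2 (by omega))) (m 1)
    (List.mem_range.2 (by omega))
  have hm2 : a + b - m 0 - m 1 = m 2 := by omega
  rw [hm2] at hv
  have hz := evalTerms_eq_zero_of_vanishes (p : RatFun 3) hv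
  rw [evalTerms_append, evalTerms_negTerms, evalTerms_shiftTerms, ← sub_eq_add_neg,
    sub_eq_zero] at hz
  rw [← hz]
  have hpow : (p : RatFun 3) ^ (3 * (a + b)) =
      (p : RatFun 3) ^ (3 * (a + b) - (m 0 + 2 * m 1 + 3 * m 2)) *
        (p : RatFun 3) ^ (m 0 + 2 * m 1 + 3 * m 2) := by
    rw [← pow_add, Nat.sub_add_cancel (by omega)]
  have hprod : ∏ i : Fin 3, (x i / (p : RatFun 3) ^ ((i : ℕ) + 1)) ^ m i =
      (∏ l : Fin 3, x l ^ m l) / (p : RatFun 3) ^ (m 0 + 2 * m 1 + 3 * m 2) := by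
    simp only [Fin.prod_univ_three, div_pow, pow_add, pow_mul]
    simp
    field_simp
  rw [hprod, hpow]
  field_simp

end Expansion

end GLHecke

/-! ### The table of spherical images. -/

set_option maxHeartbeats 1000000 in
theorem mainTheorem3 (p : ℕ) [Fact p.Prime] :
    (ω p (t p ![0, 0, 0]) = 1 :) ∧
    (ω p (t p ![0, 0, 1]) =
      sym 1 0 0 / p :) ∧
    (ω p (t p ![0, 1, 1]) =
      sym 1 1 0 / p ^ 3 :) ∧
    (ω p (t p ![0, 0, 2]) =
      (p - 1) * sym 1 1 0 / p ^ 3 + sym 2 0 0 / p ^ 2 :) ∧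
    (ω p (t p ![0, 1, 2]) =
      (2 * p ^ 2 - p - 1) * sym 1 1 1 / p ^ 6 + sym 2 1 0 / p ^ 4 :) ∧
    (ω p (t p ![0, 2, 2]) =
      (p - 1) * sym 2 1 1 / p ^ 7 + sym 2 2 0 / p ^ 6 :) ∧
    (ω p (t p ![0, 0, 3]) =
      (p ^ 2 - 2 * p + 1) * sym 1 1 1 / p ^ 5 + (p ^ 2 - p) * sym 2 1 0 / p ^ 5
      + sym 3 0 0 / p ^ 3 :) ∧
    (ω p (t p ![0, 1, 3]) =
      (2 * p - 2) * sym 2 1 1 / p ^ 6 + (p - 1) * sym 2 2 0 / p ^ 6 + sym 3 1 0 / p ^ 5 :) ∧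
    (ω p (t p ![0, 2, 3]) =
      (2 * p - 2) * sym 2 2 1 / p ^ 8 + (p - 1) * sym 3 1 1 / p ^ 8 + sym 3 2 0 / p ^ 7 :) ∧
    (ω p (t p ![0, 3, 3]) =
      (p ^ 2 - 2 * p + 1) * sym 2 2 2 / p ^ 11 + (p ^ 2 - p) * sym 3 2 1 / p ^ 11
      + sym 3 3 0 / p ^ 9 :) ∧
    (ω p (t p ![0, 0, 4]) =
      (p ^ 2 - 2 * p + 1) * sym 2 1 1 / p ^ 6 + (p ^ 2 - p) * sym 2 2 0 / p ^ 6
      + (p ^ 2 - p) * sym 3 1 0 / p ^ 6 + sym 4 0 0 / p ^ 4 :) ∧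
    (ω p (t p ![0, 1, 4]) =
      (2 * p ^ 2 - 3 * p + 1) * sym 2 2 1 / p ^ 8 + (2 * p ^ 2 - 2 * p) * sym 3 1 1 / p ^ 8
      + (p ^ 2 - p) * sym 3 2 0 / p ^ 8 + sym 4 1 0 / p ^ 6 :) ∧
    (ω p (t p ![0, 2, 4]) =
      (3 * p ^ 3 - 4 * p ^ 2 + 2 * p - 1) * sym 2 2 2 / p ^ 11
      + (2 * p ^ 3 - 3 * p ^ 2 + p) * sym 3 2 1 / p ^ 11
      + (p ^ 3 - p ^ 2) * sym 3 3 0 / p ^ 11 + (p ^ 3 - p ^ 2) * sym 4 1 1 / p ^ 11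
      + sym 4 2 0 / p ^ 8 :) ∧
    (ω p (t p ![0, 3, 4]) =
      (2 * p ^ 2 - 3 * p + 1) * sym 3 2 2 / p ^ 12
      + (2 * p ^ 2 - 2 * p) * sym 3 3 1 / p ^ 12 + (p ^ 2 - p) * sym 4 2 1 / p ^ 12
      + sym 4 3 0 / p ^ 10 :) ∧
    (ω p (t p ![0, 4, 4]) =
      (p ^ 2 - 2 * p + 1) * sym 3 3 2 / p ^ 14 + (p ^ 2 - p) * sym 4 2 2 / p ^ 14
      + (p ^ 2 - p) * sym 4 3 1 / p ^ 14 + sym 4 4 0 / p ^ 12 :) ∧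
    (ω p (t p ![0, 0, 5]) =
      (p ^ 2 - 2 * p + 1) * sym 2 2 1 / p ^ 7 + (p ^ 2 - 2 * p + 1) * sym 3 1 1 / p ^ 7
      + (p ^ 2 - p) * sym 3 2 0 / p ^ 7 + (p ^ 2 - p) * sym 4 1 0 / p ^ 7
      + sym 5 0 0 / p ^ 5 :) ∧
    (ω p (t p ![0, 1, 5]) =
      (2 * p ^ 2 - 4 * p + 2) * sym 2 2 2 / p ^ 9
      + (2 * p ^ 2 - 3 * p + 1) * sym 3 2 1 / p ^ 9 + (p ^ 2 - p) * sym 3 3 0 / p ^ 9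
      + (2 * p ^ 2 - 2 * p) * sym 4 1 1 / p ^ 9 + (p ^ 2 - p) * sym 4 2 0 / p ^ 9
      + sym 5 1 0 / p ^ 7 :) ∧
    (ω p (t p ![0, 2, 5]) =
      (3 * p ^ 3 - 5 * p ^ 2 + 3 * p - 1) * sym 3 2 2 / p ^ 12
      + (2 * p ^ 3 - 4 * p ^ 2 + 2 * p) * sym 3 3 1 / p ^ 12
      + (2 * p ^ 3 - 3 * p ^ 2 + p) * sym 4 2 1 / p ^ 12
      + (p ^ 3 - p ^ 2) * sym 4 3 0 / p ^ 12 + (p ^ 3 - p ^ 2) * sym 5 1 1 / p ^ 12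
      + sym 5 2 0 / p ^ 9 :) ∧
    (ω p (t p ![0, 3, 5]) =
      (3 * p ^ 3 - 5 * p ^ 2 + 3 * p - 1) * sym 3 3 2 / p ^ 14
      + (2 * p ^ 3 - 4 * p ^ 2 + 2 * p) * sym 4 2 2 / p ^ 14
      + (2 * p ^ 3 - 3 * p ^ 2 + p) * sym 4 3 1 / p ^ 14
      + (p ^ 3 - p ^ 2) * sym 4 4 0 / p ^ 14 + (p ^ 3 - p ^ 2) * sym 5 2 1 / p ^ 14
      + sym 5 3 0 / p ^ 11 :) ∧
    (ω p (t p ![0, 4, 5]) =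
      (2 * p ^ 2 - 4 * p + 2) * sym 3 3 3 / p ^ 15
      + (2 * p ^ 2 - 3 * p + 1) * sym 4 3 2 / p ^ 15
      + (2 * p ^ 2 - 2 * p) * sym 4 4 1 / p ^ 15 + (p ^ 2 - p) * sym 5 2 2 / p ^ 15
      + (p ^ 2 - p) * sym 5 3 1 / p ^ 15 + sym 5 4 0 / p ^ 13 :) ∧
    (ω p (t p ![0, 5, 5]) =
      (p ^ 2 - 2 * p + 1) * sym 4 3 3 / p ^ 17 + (p ^ 2 - 2 * p + 1) * sym 4 4 2 / p ^ 17
      + (p ^ 2 - p) * sym 5 3 2 / p ^ 17 + (p ^ 2 - p) * sym 5 4 1 / p ^ 17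
      + sym 5 5 0 / p ^ 15 :) ∧
    (ω p (t p ![0, 0, 6]) =
      (p ^ 2 - 2 * p + 1) * sym 2 2 2 / p ^ 8 + (p ^ 2 - 2 * p + 1) * sym 3 2 1 / p ^ 8
      + (p ^ 2 - p) * sym 3 3 0 / p ^ 8 + (p ^ 2 - 2 * p + 1) * sym 4 1 1 / p ^ 8
      + (p ^ 2 - p) * sym 4 2 0 / p ^ 8 + (p ^ 2 - p) * sym 5 1 0 / p ^ 8
      + sym 6 0 0 / p ^ 6 :) ∧
    (ω p (t p ![0, 1, 6]) =
      (2 * p ^ 2 - 4 * p + 2) * sym 3 2 2 / p ^ 10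
      + (2 * p ^ 2 - 3 * p + 1) * sym 3 3 1 / p ^ 10
      + (2 * p ^ 2 - 3 * p + 1) * sym 4 2 1 / p ^ 10 + (p ^ 2 - p) * sym 4 3 0 / p ^ 10
      + (2 * p ^ 2 - 2 * p) * sym 5 1 1 / p ^ 10 + (p ^ 2 - p) * sym 5 2 0 / p ^ 10
      + sym 6 1 0 / p ^ 8 :) ∧
    (ω p (t p ![0, 2, 6]) =
      (3 * p ^ 3 - 6 * p ^ 2 + 4 * p - 1) * sym 3 3 2 / p ^ 13
      + (3 * p ^ 3 - 5 * p ^ 2 + 3 * p - 1) * sym 4 2 2 / p ^ 13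
      + (2 * p ^ 3 - 4 * p ^ 2 + 2 * p) * sym 4 3 1 / p ^ 13
      + (p ^ 3 - p ^ 2) * sym 4 4 0 / p ^ 13
      + (2 * p ^ 3 - 3 * p ^ 2 + p) * sym 5 2 1 / p ^ 13
      + (p ^ 3 - p ^ 2) * sym 5 3 0 / p ^ 13 + (p ^ 3 - p ^ 2) * sym 6 1 1 / p ^ 13
      + sym 6 2 0 / p ^ 10 :) ∧
    (ω p (t p ![0, 3, 6]) =
      (4 * p ^ 3 - 7 * p ^ 2 + 5 * p - 2) * sym 3 3 3 / p ^ 15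
      + (3 * p ^ 3 - 6 * p ^ 2 + 4 * p - 1) * sym 4 3 2 / p ^ 15
      + (2 * p ^ 3 - 4 * p ^ 2 + 2 * p) * sym 4 4 1 / p ^ 15
      + (2 * p ^ 3 - 4 * p ^ 2 + 2 * p) * sym 5 2 2 / p ^ 15
      + (2 * p ^ 3 - 3 * p ^ 2 + p) * sym 5 3 1 / p ^ 15
      + (p ^ 3 - p ^ 2) * sym 5 4 0 / p ^ 15 + (p ^ 3 - p ^ 2) * sym 6 2 1 / p ^ 15
      + sym 6 3 0 / p ^ 12 :) ∧
    (ω p (t p ![0, 4, 6]) =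
      (3 * p ^ 3 - 6 * p ^ 2 + 4 * p - 1) * sym 4 3 3 / p ^ 17
      + (3 * p ^ 3 - 5 * p ^ 2 + 3 * p - 1) * sym 4 4 2 / p ^ 17
      + (2 * p ^ 3 - 4 * p ^ 2 + 2 * p) * sym 5 3 2 / p ^ 17
      + (2 * p ^ 3 - 3 * p ^ 2 + p) * sym 5 4 1 / p ^ 17
      + (p ^ 3 - p ^ 2) * sym 5 5 0 / p ^ 17 + (p ^ 3 - p ^ 2) * sym 6 2 2 / p ^ 17
      + (p ^ 3 - p ^ 2) * sym 6 3 1 / p ^ 17 + sym 6 4 0 / p ^ 14 :) ∧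
    (ω p (t p ![0, 5, 6]) =
      (2 * p ^ 2 - 4 * p + 2) * sym 4 4 3 / p ^ 18
      + (2 * p ^ 2 - 3 * p + 1) * sym 5 3 3 / p ^ 18
      + (2 * p ^ 2 - 3 * p + 1) * sym 5 4 2 / p ^ 18
      + (2 * p ^ 2 - 2 * p) * sym 5 5 1 / p ^ 18 + (p ^ 2 - p) * sym 6 3 2 / p ^ 18
      + (p ^ 2 - p) * sym 6 4 1 / p ^ 18 + sym 6 5 0 / p ^ 16 :) ∧
    (ω p (t p ![0, 6, 6]) =
      (p ^ 2 - 2 * p + 1) * sym 4 4 4 / p ^ 20 + (p ^ 2 - 2 * p + 1) * sym 5 4 3 / p ^ 20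
      + (p ^ 2 - 2 * p + 1) * sym 5 5 2 / p ^ 20 + (p ^ 2 - p) * sym 6 3 3 / p ^ 20
      + (p ^ 2 - p) * sym 6 4 2 / p ^ 20 + (p ^ 2 - p) * sym 6 5 1 / p ^ 20
      + sym 6 6 0 / p ^ 18 :) := by
  refine ⟨?_, ?_, ?_, ?_, ?_, ?_, ?_, ?_, ?_, ?_, ?_, ?_, ?_, ?_, ?_, ?_, ?_, ?_, ?_, ?_, ?_, ?_, ?_,
    ?_, ?_, ?_, ?_, ?_⟩
  -- Each list transcribes the right-hand side: terms of the coefficient, index of `sym`, exponent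
  -- of the denominator. The kernel evaluates the check, which does not involve `p`.
  · refine (ω_t_eq_symComb p (a := 0) (b := 0) (by decide)
      [([(1, 0)], (0, 0, 0), 0)]
      (by decide +kernel)).trans ?_
    simp [symComb, sym_zero]
  · refine (ω_t_eq_symComb p (a := 0) (b := 1) (by decide)
      [([(1, 0)], (1, 0, 0), 1)]
      (by decide +kernel)).trans ?_
    simp [symComb]
  · refine (ω_t_eq_symComb p (a := 1) (b := 1) (by decide)
      [([(1, 0)], (1, 1, 0), 3)]
      (by decide +kernel)).trans ?_
    simp [symComb]
  · refine (ω_t_eq_symComb p (a := 0) (b := 2) (by decide)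
      [([(1, 1), (-1, 0)], (1, 1, 0), 3), ([(1, 0)], (2, 0, 0), 2)]
      (by decide +kernel)).trans ?_
    simp [symComb]
    ring
  · refine (ω_t_eq_symComb p (a := 1) (b := 2) (by decide)
      [([(2, 2), (-1, 1), (-1, 0)], (1, 1, 1), 6), ([(1, 0)], (2, 1, 0), 4)]
      (by decide +kernel)).trans ?_
    simp [symComb]
    ring
  · refine (ω_t_eq_symComb p (a := 2) (b := 2) (by decide)
      [([(1, 1), (-1, 0)], (2, 1, 1), 7), ([(1, 0)], (2, 2, 0), 6)]
      (by decide +kernel)).trans ?_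
    simp [symComb]
    ring
  · refine (ω_t_eq_symComb p (a := 0) (b := 3) (by decide)
      [([(1, 2), (-2, 1), (1, 0)], (1, 1, 1), 5), ([(1, 2), (-1, 1)], (2, 1, 0), 5),
        ([(1, 0)], (3, 0, 0), 3)]
      (by decide +kernel)).trans ?_
    simp [symComb]
    ring
  · refine (ω_t_eq_symComb p (a := 1) (b := 3) (by decide)
      [([(2, 1), (-2, 0)], (2, 1, 1), 6), ([(1, 1), (-1, 0)], (2, 2, 0), 6),
        ([(1, 0)], (3, 1, 0), 5)]
      (by decide +kernel)).trans ?_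
    simp [symComb]
    ring
  · refine (ω_t_eq_symComb p (a := 2) (b := 3) (by decide)
      [([(2, 1), (-2, 0)], (2, 2, 1), 8), ([(1, 1), (-1, 0)], (3, 1, 1), 8),
        ([(1, 0)], (3, 2, 0), 7)]
      (by decide +kernel)).trans ?_
    simp [symComb]
    ring
  · refine (ω_t_eq_symComb p (a := 3) (b := 3) (by decide)
      [([(1, 2), (-2, 1), (1, 0)], (2, 2, 2), 11), ([(1, 2), (-1, 1)], (3, 2, 1), 11),
        ([(1, 0)], (3, 3, 0), 9)]
      (by decide +kernel)).trans ?_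
    simp [symComb]
    ring
  · refine (ω_t_eq_symComb p (a := 0) (b := 4) (by decide)
      [([(1, 2), (-2, 1), (1, 0)], (2, 1, 1), 6), ([(1, 2), (-1, 1)], (2, 2, 0), 6),
        ([(1, 2), (-1, 1)], (3, 1, 0), 6), ([(1, 0)], (4, 0, 0), 4)]
      (by decide +kernel)).trans ?_
    simp [symComb]
    ring
  · refine (ω_t_eq_symComb p (a := 1) (b := 4) (by decide)
      [([(2, 2), (-3, 1), (1, 0)], (2, 2, 1), 8), ([(2, 2), (-2, 1)], (3, 1, 1), 8),
        ([(1, 2), (-1, 1)], (3, 2, 0), 8), ([(1, 0)], (4, 1, 0), 6)]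
      (by decide +kernel)).trans ?_
    simp [symComb]
    ring
  · refine (ω_t_eq_symComb p (a := 2) (b := 4) (by decide)
      [([(3, 3), (-4, 2), (2, 1), (-1, 0)], (2, 2, 2), 11),
        ([(2, 3), (-3, 2), (1, 1)], (3, 2, 1), 11), ([(1, 3), (-1, 2)], (3, 3, 0), 11),
        ([(1, 3), (-1, 2)], (4, 1, 1), 11), ([(1, 0)], (4, 2, 0), 8)]
      (by decide +kernel)).trans ?_
    simp [symComb]
    ring
  · refine (ω_t_eq_symComb p (a := 3) (b := 4) (by decide)
      [([(2, 2), (-3, 1), (1, 0)], (3, 2, 2), 12), ([(2, 2), (-2, 1)], (3, 3, 1), 12),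
        ([(1, 2), (-1, 1)], (4, 2, 1), 12), ([(1, 0)], (4, 3, 0), 10)]
      (by decide +kernel)).trans ?_
    simp [symComb]
    ring
  · refine (ω_t_eq_symComb p (a := 4) (b := 4) (by decide)
      [([(1, 2), (-2, 1), (1, 0)], (3, 3, 2), 14), ([(1, 2), (-1, 1)], (4, 2, 2), 14),
        ([(1, 2), (-1, 1)], (4, 3, 1), 14), ([(1, 0)], (4, 4, 0), 12)]
      (by decide +kernel)).trans ?_
    simp [symComb]
    ring
  · refine (ω_t_eq_symComb p (a := 0) (b := 5) (by decide)
      [([(1, 2), (-2, 1), (1, 0)], (2, 2, 1), 7), ([(1, 2), (-2, 1), (1, 0)], (3, 1, 1), 7),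
        ([(1, 2), (-1, 1)], (3, 2, 0), 7), ([(1, 2), (-1, 1)], (4, 1, 0), 7),
        ([(1, 0)], (5, 0, 0), 5)]
      (by decide +kernel)).trans ?_
    simp [symComb]
    ring
  · refine (ω_t_eq_symComb p (a := 1) (b := 5) (by decide)
      [([(2, 2), (-4, 1), (2, 0)], (2, 2, 2), 9), ([(2, 2), (-3, 1), (1, 0)], (3, 2, 1), 9),
        ([(1, 2), (-1, 1)], (3, 3, 0), 9), ([(2, 2), (-2, 1)], (4, 1, 1), 9),
        ([(1, 2), (-1, 1)], (4, 2, 0), 9), ([(1, 0)], (5, 1, 0), 7)]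
      (by decide +kernel)).trans ?_
    simp [symComb]
    ring
  · refine (ω_t_eq_symComb p (a := 2) (b := 5) (by decide)
      [([(3, 3), (-5, 2), (3, 1), (-1, 0)], (3, 2, 2), 12),
        ([(2, 3), (-4, 2), (2, 1)], (3, 3, 1), 12), ([(2, 3), (-3, 2), (1, 1)], (4, 2, 1), 12),
        ([(1, 3), (-1, 2)], (4, 3, 0), 12), ([(1, 3), (-1, 2)], (5, 1, 1), 12),
        ([(1, 0)], (5, 2, 0), 9)]
      (by decide +kernel)).trans ?_
    simp [symComb]
    ring
  · refine (ω_t_eq_symComb p (a := 3) (b := 5) (by decide)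
      [([(3, 3), (-5, 2), (3, 1), (-1, 0)], (3, 3, 2), 14),
        ([(2, 3), (-4, 2), (2, 1)], (4, 2, 2), 14), ([(2, 3), (-3, 2), (1, 1)], (4, 3, 1), 14),
        ([(1, 3), (-1, 2)], (4, 4, 0), 14), ([(1, 3), (-1, 2)], (5, 2, 1), 14),
        ([(1, 0)], (5, 3, 0), 11)]
      (by decide +kernel)).trans ?_
    simp [symComb]
    ring
  · refine (ω_t_eq_symComb p (a := 4) (b := 5) (by decide)
      [([(2, 2), (-4, 1), (2, 0)], (3, 3, 3), 15), ([(2, 2), (-3, 1), (1, 0)], (4, 3, 2), 15),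
        ([(2, 2), (-2, 1)], (4, 4, 1), 15), ([(1, 2), (-1, 1)], (5, 2, 2), 15),
        ([(1, 2), (-1, 1)], (5, 3, 1), 15), ([(1, 0)], (5, 4, 0), 13)]
      (by decide +kernel)).trans ?_
    simp [symComb]
    ring
  · refine (ω_t_eq_symComb p (a := 5) (b := 5) (by decide)
      [([(1, 2), (-2, 1), (1, 0)], (4, 3, 3), 17), ([(1, 2), (-2, 1), (1, 0)], (4, 4, 2), 17),
        ([(1, 2), (-1, 1)], (5, 3, 2), 17), ([(1, 2), (-1, 1)], (5, 4, 1), 17),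
        ([(1, 0)], (5, 5, 0), 15)]
      (by decide +kernel)).trans ?_
    simp [symComb]
    ring
  · refine (ω_t_eq_symComb p (a := 0) (b := 6) (by decide)
      [([(1, 2), (-2, 1), (1, 0)], (2, 2, 2), 8), ([(1, 2), (-2, 1), (1, 0)], (3, 2, 1), 8),
        ([(1, 2), (-1, 1)], (3, 3, 0), 8), ([(1, 2), (-2, 1), (1, 0)], (4, 1, 1), 8),
        ([(1, 2), (-1, 1)], (4, 2, 0), 8), ([(1, 2), (-1, 1)], (5, 1, 0), 8),
        ([(1, 0)], (6, 0, 0), 6)]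
      (by decide +kernel)).trans ?_
    simp [symComb]
    ring
  · refine (ω_t_eq_symComb p (a := 1) (b := 6) (by decide)
      [([(2, 2), (-4, 1), (2, 0)], (3, 2, 2), 10), ([(2, 2), (-3, 1), (1, 0)], (3, 3, 1), 10),
        ([(2, 2), (-3, 1), (1, 0)], (4, 2, 1), 10), ([(1, 2), (-1, 1)], (4, 3, 0), 10),
        ([(2, 2), (-2, 1)], (5, 1, 1), 10), ([(1, 2), (-1, 1)], (5, 2, 0), 10),
        ([(1, 0)], (6, 1, 0), 8)]
      (by decide +kernel)).trans ?_
    simp [symComb]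
    ring
  · refine (ω_t_eq_symComb p (a := 2) (b := 6) (by decide)
      [([(3, 3), (-6, 2), (4, 1), (-1, 0)], (3, 3, 2), 13),
        ([(3, 3), (-5, 2), (3, 1), (-1, 0)], (4, 2, 2), 13),
        ([(2, 3), (-4, 2), (2, 1)], (4, 3, 1), 13), ([(1, 3), (-1, 2)], (4, 4, 0), 13),
        ([(2, 3), (-3, 2), (1, 1)], (5, 2, 1), 13), ([(1, 3), (-1, 2)], (5, 3, 0), 13),
        ([(1, 3), (-1, 2)], (6, 1, 1), 13), ([(1, 0)], (6, 2, 0), 10)]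
      (by decide +kernel)).trans ?_
    simp [symComb]
    ring
  · refine (ω_t_eq_symComb p (a := 3) (b := 6) (by decide)
      [([(4, 3), (-7, 2), (5, 1), (-2, 0)], (3, 3, 3), 15),
        ([(3, 3), (-6, 2), (4, 1), (-1, 0)], (4, 3, 2), 15),
        ([(2, 3), (-4, 2), (2, 1)], (4, 4, 1), 15), ([(2, 3), (-4, 2), (2, 1)], (5, 2, 2), 15),
        ([(2, 3), (-3, 2), (1, 1)], (5, 3, 1), 15), ([(1, 3), (-1, 2)], (5, 4, 0), 15),
        ([(1, 3), (-1, 2)], (6, 2, 1), 15), ([(1, 0)], (6, 3, 0), 12)]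
      (by decide +kernel)).trans ?_
    simp [symComb]
    ring
  · refine (ω_t_eq_symComb p (a := 4) (b := 6) (by decide)
      [([(3, 3), (-6, 2), (4, 1), (-1, 0)], (4, 3, 3), 17),
        ([(3, 3), (-5, 2), (3, 1), (-1, 0)], (4, 4, 2), 17),
        ([(2, 3), (-4, 2), (2, 1)], (5, 3, 2), 17), ([(2, 3), (-3, 2), (1, 1)], (5, 4, 1), 17),
        ([(1, 3), (-1, 2)], (5, 5, 0), 17), ([(1, 3), (-1, 2)], (6, 2, 2), 17),
        ([(1, 3), (-1, 2)], (6, 3, 1), 17), ([(1, 0)], (6, 4, 0), 14)]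
      (by decide +kernel)).trans ?_
    simp [symComb]
    ring
  · refine (ω_t_eq_symComb p (a := 5) (b := 6) (by decide)
      [([(2, 2), (-4, 1), (2, 0)], (4, 4, 3), 18), ([(2, 2), (-3, 1), (1, 0)], (5, 3, 3), 18),
        ([(2, 2), (-3, 1), (1, 0)], (5, 4, 2), 18), ([(2, 2), (-2, 1)], (5, 5, 1), 18),
        ([(1, 2), (-1, 1)], (6, 3, 2), 18), ([(1, 2), (-1, 1)], (6, 4, 1), 18),
        ([(1, 0)], (6, 5, 0), 16)]
      (by decide +kernel)).trans ?_
    simp [symComb]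
    ring
  · refine (ω_t_eq_symComb p (a := 6) (b := 6) (by decide)
      [([(1, 2), (-2, 1), (1, 0)], (4, 4, 4), 20), ([(1, 2), (-2, 1), (1, 0)], (5, 4, 3), 20),
        ([(1, 2), (-2, 1), (1, 0)], (5, 5, 2), 20), ([(1, 2), (-1, 1)], (6, 3, 3), 20),
        ([(1, 2), (-1, 1)], (6, 4, 2), 20), ([(1, 2), (-1, 1)], (6, 5, 1), 20),
        ([(1, 0)], (6, 6, 0), 18)]
      (by decide +kernel)).trans ?_
    simp [symComb]
    ring
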